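/- Let $p\in L_\infty[0,1]$ be real and uniformly positive ($p\ge c>0$ a.e.), let $q,r\in W_2^{-1}[0,1]$ be real generalized functions, where $W_2^{-1}[0,1]$ is the dual of the complex Sobolev space $W_2^1[0,1]$ with respect to $L_2[0,1]$ (so $q$ is a bounded linear functional $w\mapsto\int_0^1 q\,w\,dx$ on $W_2^1[0,1]$, and it is real if it takes real values on real functions), and let $U$ be a diagonal unitary complex $2\times2$ matrix. Consider the boundary problem $$-(py')'+(q-\lambda r)y=0,\qquad (U-1)y^{\vee}+i(U+1)y^{\wedge}=0,$$ where $y^{\wedge}=(y(0),y(1))^{T}$ and $y^{\vee}=(y^{[1]}(0),-y^{[1]}(1))^{T}$, $y^{[1]}$ being the quasi-derivative, understood in the following variational sense. Put $$\mathfrak H_U=\{y\in W_2^1[0,1] : y^{\wedge}\in\operatorname{im}(U-1)\},$$ with $y$ identified with its continuous representative, let $V$ be the diagonal matrix with $V_{kk}=-\cot\frac{\arg U_{kk}}{2}$ if $U_{kk}\ne1$ and $V_{kk}=0$ if $U_{kk}=1$, and for $\lambda\in\mathbb C$ and $y,z\in\mathfrak H_U$ let $$\langle I^+T(\lambda)y,z\rangle=\int_0^1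 p\,y'\overline{z'}\,dx+\int_0^1(q-\lambda r)\,y\overline z\,dx+\langle Vy^{\wedge},z^{\wedge}\rangle_{\mathbb C^2}.$$ A number $\lambda$ is an eigenvalue, with eigenfunction $y\in\mathfrak H_U\setminus\{0\}$, if $T(\lambda)y=0$, that is, $\langle I^+T(\lambda)y,z\rangle=0$ for all $z\in\mathfrak H_U$. Assume that for some $\xi\in\mathbb R$ the operator $I^+T(\xi)$ is positive, i.e. $\langle I^+T(\xi)y,y\rangle>0$ for every nonzero $y\in\mathfrak H_U$. Let $\lambda_1<\lambda_2<\cdots$ denote the (possibly finite, possibly empty) sequence of the real eigenvalues greater than $\xi$, in increasing order. Let $n\ge2$, suppose that $\lambda_n$ and $\lambda_{n+1}$ exist, and let $y_n,y_{n+1}\in\mathfrak H_U$ be eigenfunctions for $\lambda_n$ and $\lambda_{n+1}$, respectively. Then: 1. if $a<b$ are any two zeros of $y_n$ in $[0,1]$, then $y_{n+1}$ has at least one zero in the open interval $(a,b)$; 2. if $a\in[0,1]$ is any zero of $y_n$, then $y_{n+1}$ has at least one zero in $(0,a)$ provided $a>0$, and at least one zero in $(a,1)$ provided $a<1$. -/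

import Mathlib

open MeasureTheory Set
open scoped Matrix unitInterval ENNReal

noncomputable section

namespace SturmLiouville

/-- A function `f : [0,1] → ℂ` belongs to `W_2^1[0,1]`: it is an indefinite integral of a
square integrable function (this is the continuous representative of its class). -/
def MemW21 (f : I → ℂ) : Prop :=
  ∃ g : ℝ → ℂ, MemLp g 2 (volume.restrict (Icc (0 : ℝ) 1)) ∧
    ∀ t : I, f t = f 0 + ∫ s in (0 : ℝ)..(t : ℝ), g s

theorem intervalIntegrable_of_memLp {g : ℝ → ℂ}
    (hg : MemLp g 2 (volume.restrict (Icc (0 : ℝ) 1))) (t : I) :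
    IntervalIntegrable g volume 0 (t : ℝ) := by
  have h1 : IntegrableOn g (Icc (0 : ℝ) 1) := hg.integrable (by norm_num)
  rw [intervalIntegrable_iff_integrableOn_Ioc_of_le t.2.1]
  exact h1.mono_set (fun x hx => ⟨hx.1.le, hx.2.trans t.2.2⟩)

theorem ac_ofReal {f : ℝ → ℝ} {a b : ℝ} (hf : AbsolutelyContinuousOnInterval f a b) :
    AbsolutelyContinuousOnInterval (fun x => (f x : ℂ)) a b := by
  simpa [AbsolutelyContinuousOnInterval, Complex.dist_of_im_eq, Complex.isometry_ofReal.dist_eq]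
    using hf

/-- The indefinite integral of a square integrable complex function agrees on `[0,1]` with an
absolutely continuous function that has the expected derivative almost everywhere. -/
theorem exists_ac {g : ℝ → ℂ} (hg : MemLp g 2 (volume.restrict (Icc (0 : ℝ) 1))) (c : ℂ) :
    ∃ F : ℝ → ℂ, AbsolutelyContinuousOnInterval F 0 1 ∧
      (∀ t : I, F t = c + ∫ s in (0 : ℝ)..(t : ℝ), g s) ∧
      ∀ᵐ x : ℝ, x ∈ uIcc (0 : ℝ) 1 → HasDerivAt F (g x) x := by
  have h1 : IntervalIntegrable g volume 0 1 := intervalIntegrable_of_memLp hg 1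
  have hre : IntervalIntegrable (fun x => (g x).re) volume 0 1 := ⟨h1.1.re, h1.2.re⟩
  have him : IntervalIntegrable (fun x => (g x).im) volume 0 1 := ⟨h1.1.im, h1.2.im⟩
  have h0 : (0 : ℝ) ∈ uIcc (0 : ℝ) 1 := by simp
  refine ⟨fun x => c + (((∫ s in (0 : ℝ)..x, (g s).re : ℝ) : ℂ) +
    Complex.I • ((∫ s in (0 : ℝ)..x, (g s).im : ℝ) : ℂ)), ?_, ?_, ?_⟩
  · refine AbsolutelyContinuousOnInterval.fun_add ?_ (AbsolutelyContinuousOnInterval.fun_add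
      (ac_ofReal (hre.absolutelyContinuousOnInterval_intervalIntegral h0))
      ((ac_ofReal (him.absolutelyContinuousOnInterval_intervalIntegral h0)).const_smul Complex.I))
    simpa [AbsolutelyContinuousOnInterval] using tendsto_const_nhds
  · intro t
    have ht := intervalIntegrable_of_memLp hg t
    have e1 := Complex.reCLM.intervalIntegral_comp_comm ht
    have e2 := Complex.imCLM.intervalIntegral_comp_comm ht
    simp only [Complex.reCLM_apply, Complex.imCLM_apply] at e1 e2
    simp only [e1, e2]
    congr 1
    apply Complex.ext <;> simp
  · filter_upwards [hre.ae_hasDerivAt_integral, him.ae_hasDerivAt_integral] with x h2 h3 hx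
    have := (((h2 hx 0 h0).ofReal_comp).add
      (((h3 hx 0 h0).ofReal_comp).const_smul Complex.I)).const_add c
    convert! this using 1
    apply Complex.ext <;> simp

theorem MemW21.mul {f h : I → ℂ} (hf : MemW21 f) (hh : MemW21 h) : MemW21 (f * h) := by
  obtain ⟨a, ha, hfa⟩ := hf
  obtain ⟨b, hb, hhb⟩ := hh
  obtain ⟨F, hF, hFf, hFd⟩ := exists_ac ha (f 0)
  obtain ⟨H, hH, hHh, hHd⟩ := exists_ac hb (h 0)
  have bdd : ∀ {G : ℝ → ℂ}, AbsolutelyContinuousOnInterval G 0 1 →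
      MemLp G ∞ (volume.restrict (Icc (0 : ℝ) 1)) := by
    intro G hG
    obtain ⟨C, hC⟩ := hG.exists_bound
    have hc := hG.continuousOn
    rw [uIcc_of_le zero_le_one] at hC hc
    exact memLp_top_of_bound (hc.aestronglyMeasurable measurableSet_Icc) C
      ((ae_restrict_iff' measurableSet_Icc).2 (Filter.Eventually.of_forall hC))
  have hk : MemLp (fun x => a x * H x + F x * b x) 2 (volume.restrict (Icc (0 : ℝ) 1)) :=
    ((bdd hH).mul' ha).add (hb.mul' (bdd hF))
  obtain ⟨K, hK, hKk, hKd⟩ := exists_ac hk (f 0 * h 0)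
  have hac : AbsolutelyContinuousOnInterval (fun x => F x • H x - K x) 0 1 :=
    (hF.fun_smul hH).fun_sub hK
  obtain ⟨C, hC⟩ := hac.const_of_ae_hasDerivAt_zero (by
    filter_upwards [hFd, hHd, hKd] with x h1 h2 h3 hx
    have := ((h1 hx).mul (h2 hx)).sub (h3 hx)
    convert! this using 1
    ring)
  have mem : ∀ t : I, (t : ℝ) ∈ uIcc (0 : ℝ) 1 := fun t => by
    rw [uIcc_of_le zero_le_one]; exact t.2
  refine ⟨_, hk, fun t => ?_⟩
  have hC0 := hC _ (mem 0)
  have hCt := hC _ (mem t)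
  simp only [smul_eq_mul, hFf, hHh, hKk] at hC0 hCt
  rw [← hfa, ← hhb] at hC0 hCt
  simp only [Icc.coe_zero, intervalIntegral.integral_same, add_zero, sub_self] at hC0
  simp only [Pi.mul_apply]
  rw [← hC0] at hCt
  linear_combination hCt

/-- The complex Sobolev space `W_2^1[0,1]`, an algebra of functions under pointwise
multiplication, with pointwise conjugation as `star`. -/
def W21 : StarSubalgebra ℂ (I → ℂ) where
  carrier := {f | MemW21 f}
  mul_mem' := MemW21.mul
  add_mem' := by
    rintro f h ⟨a, ha, hfa⟩ ⟨b, hb, hhb⟩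
    refine ⟨_, ha.add hb, fun t => ?_⟩
    have := intervalIntegral.integral_add (intervalIntegrable_of_memLp ha t)
      (intervalIntegrable_of_memLp hb t)
    simp only [Pi.add_apply] at this ⊢
    rw [this, hfa t, hhb t]
    ring
  algebraMap_mem' := fun c => ⟨0, MemLp.zero, fun t => by simp [Pi.algebraMap_apply]⟩
  star_mem' := by
    rintro f ⟨a, ha, hfa⟩
    refine ⟨star a, ha.star, fun t => ?_⟩
    simp only [Pi.star_apply]
    rw [hfa t, star_add]
    congr 1
    exact (intervalIntegral.intervalIntegral_conj (f := a)).symm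

/-- The function `y`, extended to the real line by the constants `y(0)` and `y(1)`. -/
def extend01 (y : W21) : ℝ → ℂ := IccExtend (zero_le_one : (0 : ℝ) ≤ 1) (y : I → ℂ)

/-- The derivative `y'`; it exists almost everywhere on `[0,1]` and is square integrable. -/
def deriv01 (y : W21) : ℝ → ℂ := deriv (extend01 y)

/-- The norm of `W_2^1[0,1]`. -/
def normW21 (y : W21) : ℝ :=
  √(∫ t in (0 : ℝ)..1, (‖deriv01 y t‖ ^ 2 + ‖extend01 y t‖ ^ 2))

/-- The space `W_2^{-1}[0,1]`, the dual of `W_2^1[0,1]` with respect to the pivot space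
`L_2[0,1]`: a generalized function `q` is the bounded linear functional
`w ↦ ∫₀¹ q w dx` on `W_2^1[0,1]`. -/
structure WNeg where
  pairing : W21 →ₗ[ℂ] ℂ
  bounded : ∃ C : ℝ, ∀ w : W21, ‖pairing w‖ ≤ C * normW21 w

/-- A generalized function is real if its pairing commutes with complex conjugation, that is,
takes real values on real functions. -/
def WNeg.IsReal (q : WNeg) : Prop := ∀ w : W21, q.pairing (star w) = star (q.pairing w)

/-- The vector `(y(0), y(1))` of boundary values. -/
def bdry (y : W21) : Fin 2 → ℂ := ![(y : I → ℂ) 0, (y : I → ℂ) 1]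

/-- The data of the boundary problem `-(p y')' + (q - λ r) y = 0`,
`(U - 1) y^∨ + i (U + 1) y^∧ = 0`: a uniformly positive `p ∈ L_∞[0,1]`, real
`q, r ∈ W_2^{-1}[0,1]` and a diagonal unitary matrix `U`. -/
structure Problem where
  p : ℝ → ℝ
  p_memLp : MemLp p ∞ (volume.restrict (Icc (0 : ℝ) 1))
  p_unif_pos : ∃ c : ℝ, 0 < c ∧ ∀ᵐ t ∂(volume.restrict (Icc (0 : ℝ) 1)), c ≤ p t
  q : WNeg
  q_real : q.IsReal
  r : WNeg
  r_real : r.IsReal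
  U : Matrix (Fin 2) (Fin 2) ℂ
  U_unitary : U ∈ Matrix.unitaryGroup (Fin 2) ℂ
  U_diag : U.IsDiag

namespace Problem

variable (S : Problem)

/-- The space `H_U = {y ∈ W_2^1[0,1] | y^∧ ∈ im (U - 1)}`. -/
def HU : Submodule ℂ W21 where
  carrier := {y | bdry y ∈ LinearMap.range (S.U - 1).mulVecLin}
  zero_mem' := by
    have : bdry 0 = 0 := by ext k; fin_cases k <;> simp [bdry]
    simp only [mem_ofPred_eq, this]
    exact Submodule.zero_mem _
  add_mem' := by
    intro y z hy hz
    have : bdry (y + z) = bdry y + bdry z := by ext k; fin_cases k <;> simp [bdry]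
    simp only [mem_ofPred_eq, this] at *
    exact Submodule.add_mem _ hy hz
  smul_mem' := by
    intro c y hy
    have : bdry (c • y) = c • bdry y := by ext k; fin_cases k <;> simp [bdry]
    simp only [mem_ofPred_eq, this] at *
    exact Submodule.smul_mem _ c hy

/-- The diagonal matrix `V` with entries `-cot (arg U_kk / 2)` where `U_kk ≠ 1`, and `0` where
`U_kk = 1`. -/
def V : Matrix (Fin 2) (Fin 2) ℂ := by
  classical
  exact Matrix.diagonal fun k =>
    if S.U k k = 1 then 0 else ((-Real.cot (Complex.arg (S.U k k) / 2) : ℝ) : ℂ)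

/-- The sesquilinear form of the pencil `T`: for `y, z ∈ H_U` this is
`⟨I⁺ T(μ) y, z⟩ = ∫₀¹ p y' conj(z') dx + ∫₀¹ (q - μ r) y conj(z) dx + ⟨V y^∧, z^∧⟩`.
It is the polarization of the quadratic form that defines `T(μ)`; as `I⁺` is isometric,
`T(μ) y = 0` means that the form vanishes at `(y, z)` for every `z ∈ H_U`. -/
def form (μ : ℂ) (y z : S.HU) : ℂ :=
  (∫ t in (0 : ℝ)..1, (S.p t : ℂ) * deriv01 (y : W21) t * star (deriv01 (z : W21) t))
    + (S.q.pairing ((y : W21) * star (z : W21)) - μ * S.r.pairing ((y : W21) * star (z : W21)))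
    + (S.V *ᵥ bdry y) ⬝ᵥ star (bdry z)

/-- The operator `I⁺ T(ξ)` on `H_U` is positive: its quadratic form (which is real, because `p`,
`q`, `r`, `V` and `ξ` are) is strictly positive on nonzero vectors. -/
def Positive (ξ : ℝ) : Prop := ∀ y : S.HU, y ≠ 0 → 0 < (S.form (ξ : ℂ) y y).re

/-- `y` is an eigenfunction of the pencil at `μ`: a nonzero solution of `T(μ) y = 0`. -/
def IsEigenfunction (μ : ℂ) (y : S.HU) : Prop := y ≠ 0 ∧ ∀ z : S.HU, S.form μ y z = 0

/-- `μ` is an eigenvalue of the pencil. -/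
def IsEigenvalue (μ : ℂ) : Prop := ∃ y : S.HU, S.IsEigenfunction μ y

/-- `μ` is the eigenvalue `λ_n`, `n ≥ 1`: the `n`-th eigenvalue to the right of `ξ` in
increasing order, that is, there are exactly `n - 1` eigenvalues in the interval `(ξ, μ)`. -/
def IsEigenvalueAbove (ξ : ℝ) (n : ℕ) (μ : ℝ) : Prop :=
  ξ < μ ∧ S.IsEigenvalue (μ : ℂ) ∧
    {ν : ℝ | ν ∈ Ioo ξ μ ∧ S.IsEigenvalue (ν : ℂ)}.encard + 1 = (n : ℕ∞)

/-- The point `a ∈ [0,1]` is a zero of `y`. -/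
def IsZero (y : S.HU) (a : I) : Prop := ((y : W21) : I → ℂ) a = 0

end Problem

end SturmLiouville

end

/-!
A generalized function in `W_2^{-1}` acts on derivatives as a square integrable density, so the
form of the pencil is an integral of `p y' conj z'` and of lower order terms, and an eigenfunction
together with its quasi-derivative solves a linear first-order system with integrable coefficients.
Gronwall's inequality gives unique continuation; hence the eigenfunctions at a real point are
proportional, and each of them is a multiple of a real one.

Let `z` be `y_n` on `[a, b]` and zero elsewhere. The form at `λ_n` vanishes at `(z, z)`, positivity
at `ξ < λ_n` then makes `∫ r |z|²` positive, and so the form at `λ_{n+1} > λ_n` is negative at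
`(z, z)`. If `y_{n+1}` had no zero in `(a, b)`, it could be taken positive there, and Picone's
inequality, that is, testing the equation of `u = y_{n+1}` against `z² / (u + ε)` and letting
`ε → 0`, would show that the same form is nonnegative at `(z, z)`.
-/

noncomputable section

namespace SturmLiouville

open Filter Topology

section AbsolutelyContinuous

variable {a b : ℝ}

theorem absolutelyContinuousOnInterval_of_dist_le {X Y : Type*} [PseudoMetricSpace X]
    [PseudoMetricSpace Y] {f : ℝ → X} {g : ℝ → Y} (hg : AbsolutelyContinuousOnInterval g a b)
    {L : ℝ} (h : ∀ s ∈ uIcc a b, ∀ t ∈ uIcc a b, dist (f s) (f t) ≤ L * dist (g s) (g t)) :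
    AbsolutelyContinuousOnInterval f a b := by
  have hlim := Tendsto.const_mul L hg
  rw [mul_zero] at hlim
  refine squeeze_zero' (.of_forall fun E => Finset.sum_nonneg fun i _ => dist_nonneg) ?_ hlim
  filter_upwards [mem_inf_of_right (mem_principal_self _)] with E hE
  rw [Finset.mul_sum]
  exact Finset.sum_le_sum fun i hi => h _ (hE.1 i hi).1 _ (hE.1 i hi).2

variable {E : Type*} [NormedAddCommGroup E] [NormedSpace ℝ E]

theorem absolutelyContinuousOnInterval_intervalIntegral {g : ℝ → E} {c : ℝ}
    (hg : IntervalIntegrable g volume a b) (hc : c ∈ uIcc a b) :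
    AbsolutelyContinuousOnInterval (fun x => ∫ s in c..x, g s) a b := by
  refine absolutelyContinuousOnInterval_of_dist_le (L := 1)
    (hg.norm.absolutelyContinuousOnInterval_intervalIntegral hc) fun s hs t ht => ?_
  have hint : ∀ x ∈ uIcc a b, IntervalIntegrable g volume c x :=
    fun x hx => hg.mono_set (uIcc_subset_uIcc hc hx)
  rw [one_mul, dist_eq_norm, dist_eq_norm,
    intervalIntegral.integral_interval_sub_left (hint s hs) (hint t ht),
    intervalIntegral.integral_interval_sub_left (hint s hs).norm (hint t ht).norm]
  exact intervalIntegral.norm_integral_le_abs_integral_norm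

variable [CompleteSpace E]

theorem intervalIntegral_eq_sub_of_ae_hasDerivAt {f g : ℝ → E}
    (hf : AbsolutelyContinuousOnInterval f a b) (hg : IntervalIntegrable g volume a b)
    (h : ∀ᵐ x, x ∈ uIcc a b → HasDerivAt f (g x) x) : ∫ x in a..b, g x = f b - f a := by
  obtain ⟨C, hC⟩ := (hf.fun_sub (absolutelyContinuousOnInterval_intervalIntegral hg
    left_mem_uIcc)).const_of_ae_hasDerivAt_zero (by
      filter_upwards [h, hg.ae_hasDerivAt_integral] with x hfx hgx hx
      simpa using (hfx hx).fun_sub (hgx hx a left_mem_uIcc))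
  have ha : f a = C := by simpa using hC a left_mem_uIcc
  rw [← ha] at hC
  rw [← hC b right_mem_uIcc, sub_sub_cancel]

end AbsolutelyContinuous

section UnitInterval

/-- Lebesgue measure on `[0,1]`. -/
abbrev vol01 : Measure ℝ := volume.restrict (Icc (0 : ℝ) 1)

theorem ae_vol01_iff {P : ℝ → Prop} : (∀ᵐ x ∂vol01, P x) ↔ ∀ᵐ x, x ∈ uIcc (0 : ℝ) 1 → P x := by
  rw [uIcc_of_le zero_le_one, ae_restrict_iff' measurableSet_Icc]

theorem ae_vol01_mem_Ioo : ∀ᵐ x ∂vol01, x ∈ Ioo (0 : ℝ) 1 := by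
  rw [vol01, ← Measure.restrict_congr_set Ioo_ae_eq_Icc]
  exact ae_restrict_mem measurableSet_Ioo

variable {E : Type*} [NormedAddCommGroup E]

theorem intervalIntegrable_of_integrable_vol01 {g : ℝ → E} (hg : Integrable g vol01) {s t : ℝ}
    (hs : s ∈ Icc (0 : ℝ) 1) (ht : t ∈ Icc (0 : ℝ) 1) : IntervalIntegrable g volume s t :=
  intervalIntegrable_iff.2 <|
    IntegrableOn.mono_set hg (uIoc_subset_uIcc.trans (uIcc_subset_Icc hs ht))

theorem memLp_top_of_continuousOn {g : ℝ → E} (hg : ContinuousOn g (Icc 0 1)) :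
    MemLp g ∞ vol01 := by
  obtain ⟨C, hC⟩ := isCompact_Icc.exists_bound_of_continuousOn hg
  exact memLp_top_of_bound (hg.aestronglyMeasurable_of_isCompact isCompact_Icc measurableSet_Icc) C
    ((ae_restrict_iff' measurableSet_Icc).2 (.of_forall hC))

variable [NormedSpace ℝ E]

theorem integral_vol01 (g : ℝ → E) : ∫ x, g x ∂vol01 = ∫ x in (0 : ℝ)..1, g x := by
  rw [intervalIntegral.integral_of_le zero_le_one, integral_Icc_eq_integral_Ioc]

theorem intervalIntegral_congr_vol01 {f g : ℝ → E} (h : f =ᵐ[vol01] g) {s t : ℝ}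
    (hs : s ∈ Icc (0 : ℝ) 1) (ht : t ∈ Icc (0 : ℝ) 1) : ∫ x in s..t, f x = ∫ x in s..t, g x := by
  refine intervalIntegral.integral_congr_ae ?_
  filter_upwards [(ae_restrict_iff' measurableSet_Icc).1 h] with x hx hxst
  exact hx (uIcc_subset_Icc hs ht (uIoc_subset_uIcc hxst))

/-- `F` is on `[0,1]` an indefinite integral of the integrable function `f`; the values of `F`
outside `[0,1]` are irrelevant. -/
structure IsPrimitive (F f : ℝ → E) : Prop where
  integrable : Integrable f vol01
  eq_add_integral : ∀ t ∈ Icc (0 : ℝ) 1, F t = F 0 + ∫ s in (0 : ℝ)..t, f s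

namespace IsPrimitive

variable {F f G g : ℝ → E} {s t : ℝ}

theorem intervalIntegrable (hF : IsPrimitive F f) (hs : s ∈ Icc (0 : ℝ) 1)
    (ht : t ∈ Icc (0 : ℝ) 1) : IntervalIntegrable f volume s t :=
  intervalIntegrable_of_integrable_vol01 hF.integrable hs ht

theorem sub_eq_integral (hF : IsPrimitive F f) (hs : s ∈ Icc (0 : ℝ) 1)
    (ht : t ∈ Icc (0 : ℝ) 1) : F t - F s = ∫ x in s..t, f x := by
  have h0 := unitInterval.zero_mem
  rw [hF.eq_add_integral t ht, hF.eq_add_integral s hs, add_sub_add_left_eq_sub,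
    intervalIntegral.integral_interval_sub_left (hF.intervalIntegrable h0 ht)
      (hF.intervalIntegrable h0 hs)]

theorem absolutelyContinuousOnInterval (hF : IsPrimitive F f) :
    AbsolutelyContinuousOnInterval F 0 1 := by
  refine absolutelyContinuousOnInterval_of_dist_le (L := 1)
    (absolutelyContinuousOnInterval_intervalIntegral
      (hF.intervalIntegrable unitInterval.zero_mem unitInterval.one_mem) left_mem_uIcc)
    fun s hs t ht => ?_
  rw [uIcc_of_le zero_le_one] at hs ht
  rw [hF.eq_add_integral s hs, hF.eq_add_integral t ht, dist_add_left, one_mul]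

theorem continuousOn (hF : IsPrimitive F f) : ContinuousOn F (Icc 0 1) := by
  simpa only [uIcc_of_le zero_le_one] using hF.absolutelyContinuousOnInterval.continuousOn

theorem memLp_top (hF : IsPrimitive F f) : MemLp F ∞ vol01 :=
  memLp_top_of_continuousOn hF.continuousOn

theorem congr_ae (hF : IsPrimitive F f) (h : f =ᵐ[vol01] g) : IsPrimitive F g where
  integrable := hF.integrable.congr h
  eq_add_integral t ht := by
    rw [hF.eq_add_integral t ht, intervalIntegral_congr_vol01 h unitInterval.zero_mem ht]

theorem add (hF : IsPrimitive F f) (hG : IsPrimitive G g) :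
    IsPrimitive (fun t => F t + G t) (fun t => f t + g t) where
  integrable := hF.integrable.add hG.integrable
  eq_add_integral t ht := by
    rw [intervalIntegral.integral_add (hF.intervalIntegrable unitInterval.zero_mem ht)
      (hG.intervalIntegrable unitInterval.zero_mem ht), hF.eq_add_integral t ht,
      hG.eq_add_integral t ht, add_add_add_comm]

theorem const_mul {F f : ℝ → ℂ} (hF : IsPrimitive F f) (c : ℂ) :
    IsPrimitive (fun t => c * F t) (fun t => c * f t) where
  integrable := hF.integrable.const_mul c
  eq_add_integral t ht := by
    rw [intervalIntegral.integral_const_mul, hF.eq_add_integral t ht, mul_add]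

theorem prodMk {E' : Type*} [NormedAddCommGroup E'] [NormedSpace ℝ E'] [CompleteSpace E]
    [CompleteSpace E'] {G g : ℝ → E'} (hF : IsPrimitive F f) (hG : IsPrimitive G g) :
    IsPrimitive (fun t => (F t, G t)) (fun t => (f t, g t)) where
  integrable := hF.integrable.prodMk hG.integrable
  eq_add_integral t ht := by
    have hf := hF.intervalIntegrable unitInterval.zero_mem ht
    have hg := hG.intervalIntegrable unitInterval.zero_mem ht
    rw [intervalIntegral.integral_of_le ht.1, integral_pair hf.1 hg.1, hF.eq_add_integral t ht,
      hG.eq_add_integral t ht, intervalIntegral.integral_of_le ht.1,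
      intervalIntegral.integral_of_le ht.1, Prod.mk_add_mk]

variable [CompleteSpace E]

theorem ae_hasDerivAt (hF : IsPrimitive F f) : ∀ᵐ x ∂vol01, HasDerivAt F (f x) x := by
  have hint := hF.intervalIntegrable unitInterval.zero_mem unitInterval.one_mem
  filter_upwards [ae_vol01_iff.2 hint.ae_hasDerivAt_integral, ae_vol01_mem_Ioo] with x hx hx01
  refine ((hx 0 left_mem_uIcc).const_add (F 0)).congr_of_eventuallyEq ?_
  filter_upwards [Icc_mem_nhds hx01.1 hx01.2] with t ht using hF.eq_add_integral t ht

theorem of_ae_hasDerivAt (hF : AbsolutelyContinuousOnInterval F 0 1) (hf : Integrable f vol01)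
    (h : ∀ᵐ x ∂vol01, HasDerivAt F (f x) x) : IsPrimitive F f where
  integrable := hf
  eq_add_integral t ht := by
    have hsub : uIcc (0 : ℝ) t ⊆ uIcc 0 1 := by
      rw [uIcc_of_le zero_le_one]
      exact uIcc_subset_Icc unitInterval.zero_mem ht
    rw [intervalIntegral_eq_sub_of_ae_hasDerivAt (hF.mono hsub)
      (intervalIntegrable_of_integrable_vol01 hf unitInterval.zero_mem ht) (by
        filter_upwards [ae_vol01_iff.1 h] with x hx hxt using hx (hsub hxt)), add_sub_cancel]

theorem mul {F f G g : ℝ → ℂ} (hF : IsPrimitive F f) (hG : IsPrimitive G g) :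
    IsPrimitive (fun t => F t * G t) (fun t => f t * G t + F t * g t) := by
  refine of_ae_hasDerivAt (F := fun t => F t * G t)
    (hF.absolutelyContinuousOnInterval.fun_smul hG.absolutelyContinuousOnInterval)
    ((hF.integrable.mul_of_top_left hG.memLp_top).add
      (hG.integrable.mul_of_top_right hF.memLp_top)) ?_
  filter_upwards [hF.ae_hasDerivAt, hG.ae_hasDerivAt] with x hFx hGx using hFx.fun_mul hGx

theorem inv {F f : ℝ → ℂ} (hF : IsPrimitive F f) (h0 : ∀ t ∈ Icc (0 : ℝ) 1, F t ≠ 0) :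
    IsPrimitive (fun t => (F t)⁻¹) (fun t => f t * -((F t)⁻¹) ^ 2) := by
  have hcont : ContinuousOn (fun t => (F t)⁻¹) (Icc 0 1) := hF.continuousOn.inv₀ h0
  obtain ⟨C, hC⟩ := isCompact_Icc.exists_bound_of_continuousOn hcont
  refine of_ae_hasDerivAt (F := fun t => (F t)⁻¹) ?_
    (hF.integrable.mul_of_top_left (memLp_top_of_continuousOn (hcont.pow 2).neg)) ?_
  · refine absolutelyContinuousOnInterval_of_dist_le (L := C * C)
      hF.absolutelyContinuousOnInterval fun s hs t ht => ?_
    rw [uIcc_of_le zero_le_one] at hs ht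
    have hCs := hC s hs
    have hCt := hC t ht
    rw [dist_inv_inv₀ (h0 s hs) (h0 t ht), div_eq_inv_mul, mul_inv, ← norm_inv, ← norm_inv]
    gcongr
    exact (norm_nonneg _).trans hCs
  · filter_upwards [hF.ae_hasDerivAt, ae_restrict_mem measurableSet_Icc] with x hx hx01
    have hx' := hx.fun_inv (h0 x hx01)
    rwa [neg_div, div_eq_mul_inv, ← inv_pow, ← mul_neg] at hx'

end IsPrimitive

end UnitInterval

section Gronwall

namespace IsPrimitive

variable {E : Type*} [NormedAddCommGroup E] [NormedSpace ℝ E] {F f : ℝ → E} {K : ℝ → ℝ} {s : ℝ}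

theorem eventually_eq_zero_of_norm_le (hF : IsPrimitive F f) (hK : Integrable K vol01)
    (hle : ∀ᵐ x ∂vol01, ‖f x‖ ≤ K x * ‖F x‖) (hK0 : ∀ x, 0 ≤ K x)
    (hs : s ∈ Icc (0 : ℝ) 1) (hFs : F s = 0) :
    ∀ᶠ t in 𝓝[Icc 0 1] s, F t = 0 := by
  have hκ : IsPrimitive (fun t => ∫ x in (0 : ℝ)..t, K x) K := ⟨hK, fun t _ => by simp⟩
  obtain ⟨δ, hδ, hball⟩ := Metric.mem_nhdsWithin_iff.1 <|
    (hκ.continuousOn s hs).eventually (Metric.ball_mem_nhds _ (one_half_pos (α := ℝ)))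
  refine Metric.mem_nhdsWithin_iff.2 ⟨δ, hδ, fun t ht => ?_⟩
  have hsub : uIcc s t ⊆ Metric.ball s δ ∩ Icc 0 1 :=
    subset_inter ((Real.ball_eq_Ioo s δ ▸ ordConnected_Ioo).uIcc_subset
      (Metric.mem_ball_self hδ) ht.1) (uIcc_subset_Icc hs ht.2)
  obtain ⟨m, hm, hmax⟩ := isCompact_uIcc.exists_isMaxOn nonempty_uIcc
    (hF.continuousOn.mono (hsub.trans inter_subset_right)).norm
  have hm01 := (hsub hm).2
  have hsmall : |∫ x in s..m, K x| ≤ 1 / 2 := by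
    rw [← hκ.sub_eq_integral hs hm01, ← Real.dist_eq]
    exact (hball (hsub hm)).le
  have hbound : ‖∫ x in s..m, f x‖ ≤ |∫ x in s..m, K x * ‖F m‖| := by
    refine intervalIntegral.norm_integral_le_abs_of_norm_le ?_
      ((hκ.intervalIntegrable hs hm01).mul_const _)
    have hsm : uIoc s m ⊆ uIcc s t := uIoc_subset_uIcc.trans (uIcc_subset_uIcc_left hm)
    filter_upwards [ae_restrict_of_ae_restrict_of_subset
      (hsm.trans (hsub.trans inter_subset_right)) hle, ae_restrict_mem measurableSet_uIoc]
      with x hx hxm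
    exact hx.trans (mul_le_mul_of_nonneg_left (hmax (hsm hxm)) (hK0 x))
  have hFm : ‖F m‖ ≤ 1 / 2 * ‖F m‖ := by
    rw [← hF.sub_eq_integral hs hm01, hFs, sub_zero, intervalIntegral.integral_mul_const, abs_mul,
      abs_norm] at hbound
    exact hbound.trans (mul_le_mul_of_nonneg_right hsmall (norm_nonneg _))
  exact norm_le_zero_iff.1 ((hmax right_mem_uIcc).trans (by linarith))

theorem eq_zero_of_norm_le (hF : IsPrimitive F f) (hK : Integrable K vol01)
    (hle : ∀ᵐ x ∂vol01, ‖f x‖ ≤ K x * ‖F x‖) (hK0 : ∀ x, 0 ≤ K x)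
    (hs : s ∈ Icc (0 : ℝ) 1) (hFs : F s = 0) : ∀ t ∈ Icc (0 : ℝ) 1, F t = 0 := by
  have hclopen : IsClopen {t : I | F t = 0} :=
    ⟨isClosed_eq (continuousOn_iff_continuous_domRestrict.1 hF.continuousOn) continuous_const,
      isOpen_iff_mem_nhds.2 fun t ht => (eventually_nhds_subtype_iff _ t _).2 <|
        hF.eventually_eq_zero_of_norm_le hK hle hK0 t.2 ht⟩
  have huniv := hclopen.eq_univ ⟨⟨s, hs⟩, hFs⟩
  exact fun t ht => huniv.ge (mem_univ (⟨t, ht⟩ : I))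

end IsPrimitive

end Gronwall

section W21

theorem extend01_of_mem (y : W21) {t : ℝ} (ht : t ∈ Icc (0 : ℝ) 1) :
    extend01 y t = (y : I → ℂ) ⟨t, ht⟩ := IccExtend_of_mem _ _ ht

theorem extend01_coe (y : W21) (t : I) : extend01 y t = (y : I → ℂ) t := extend01_of_mem y t.2

theorem extend01_add (y z : W21) (t : ℝ) : extend01 (y + z) t = extend01 y t + extend01 z t := rfl

theorem extend01_smul (c : ℂ) (y : W21) (t : ℝ) : extend01 (c • y) t = c * extend01 y t := rfl

theorem extend01_mul (y z : W21) (t : ℝ) : extend01 (y * z) t = extend01 y t * extend01 z t := rfl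

theorem extend01_star (y : W21) (t : ℝ) : extend01 (star y) t = star (extend01 y t) := rfl

theorem ext_extend01 {y z : W21} (h : ∀ t ∈ Icc (0 : ℝ) 1, extend01 y t = extend01 z t) :
    y = z :=
  Subtype.ext <| funext fun t => by rw [← extend01_coe, ← extend01_coe, h t t.2]

theorem isPrimitive_extend01_of_memLp {y : W21} {g : ℝ → ℂ} (hg : MemLp g 2 vol01)
    (h : ∀ t : I, (y : I → ℂ) t = (y : I → ℂ) 0 + ∫ s in (0 : ℝ)..(t : ℝ), g s) :
    IsPrimitive (extend01 y) g where
  integrable := hg.integrable (by norm_num)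
  eq_add_integral t ht := by
    rw [extend01_of_mem y ht, h, extend01_of_mem y unitInterval.zero_mem]
    rfl

theorem deriv01_ae_eq {y : W21} {g : ℝ → ℂ} (h : IsPrimitive (extend01 y) g) :
    deriv01 y =ᵐ[vol01] g := by
  filter_upwards [h.ae_hasDerivAt] with x hx using hx.deriv

theorem memLp_deriv01 (y : W21) : MemLp (deriv01 y) 2 vol01 := by
  obtain ⟨g, hg, h⟩ := y.2
  exact hg.ae_eq (deriv01_ae_eq (isPrimitive_extend01_of_memLp hg h)).symm

theorem isPrimitive_extend01 (y : W21) : IsPrimitive (extend01 y) (deriv01 y) where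
  integrable := (memLp_deriv01 y).integrable (by norm_num)
  eq_add_integral t ht := by
    obtain ⟨g, hg, h⟩ := y.2
    have hy := isPrimitive_extend01_of_memLp hg h
    rw [hy.eq_add_integral t ht,
      intervalIntegral_congr_vol01 (deriv01_ae_eq hy) unitInterval.zero_mem ht]

theorem hasDerivAt_extend01 (y : W21) : ∀ᵐ x ∂vol01, HasDerivAt (extend01 y) (deriv01 y x) x :=
  (isPrimitive_extend01 y).ae_hasDerivAt

theorem continuousOn_extend01 (y : W21) : ContinuousOn (extend01 y) (Icc 0 1) :=
  (isPrimitive_extend01 y).continuousOn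

theorem memLp_top_extend01 (y : W21) : MemLp (extend01 y) ∞ vol01 :=
  (isPrimitive_extend01 y).memLp_top

theorem deriv01_add (y z : W21) :
    deriv01 (y + z) =ᵐ[vol01] fun x => deriv01 y x + deriv01 z x := by
  filter_upwards [hasDerivAt_extend01 y, hasDerivAt_extend01 z] with x hy hz
  exact (hy.add hz).deriv

theorem deriv01_smul (c : ℂ) (y : W21) :
    deriv01 (c • y) =ᵐ[vol01] fun x => c * deriv01 y x := by
  filter_upwards [hasDerivAt_extend01 y] with x hy
  exact (hy.const_mul c).deriv

theorem deriv01_mul (y z : W21) : deriv01 (y * z) =ᵐ[vol01]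
    fun x => deriv01 y x * extend01 z x + extend01 y x * deriv01 z x := by
  filter_upwards [hasDerivAt_extend01 y, hasDerivAt_extend01 z] with x hy hz
  exact (hy.mul hz).deriv

theorem deriv01_star (y : W21) : deriv01 (star y) =ᵐ[vol01] fun x => star (deriv01 y x) := by
  filter_upwards [hasDerivAt_extend01 y] with x hy
  exact hy.star.deriv

/-- The element of `W_2^1[0,1]` with value `c` at `0` and derivative `g`. -/
def primitive (c : ℂ) (g : ℝ → ℂ) (hg : MemLp g 2 vol01) : W21 :=
  ⟨fun t => c + ∫ s in (0 : ℝ)..(t : ℝ), g s, g, hg, fun t => by simp⟩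

variable {c : ℂ} {g : ℝ → ℂ} (hg : MemLp g 2 vol01)

theorem extend01_primitive {t : ℝ} (ht : t ∈ Icc (0 : ℝ) 1) :
    extend01 (primitive c g hg) t = c + ∫ s in (0 : ℝ)..t, g s :=
  extend01_of_mem _ ht

theorem extend01_zero_primitive : extend01 (primitive c g hg) 0 = c := by
  rw [extend01_primitive hg unitInterval.zero_mem, intervalIntegral.integral_same, add_zero]

theorem deriv01_primitive : deriv01 (primitive c g hg) =ᵐ[vol01] g :=
  deriv01_ae_eq <| isPrimitive_extend01_of_memLp hg fun t => by simp [primitive]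

theorem eq_primitive {y : W21} (h0 : extend01 y 0 = c) (h : deriv01 y =ᵐ[vol01] g) :
    y = primitive c g hg :=
  ext_extend01 fun t ht => by
    rw [extend01_primitive hg ht, (isPrimitive_extend01 y).eq_add_integral t ht, h0,
      intervalIntegral_congr_vol01 h unitInterval.zero_mem ht]

end W21

section Density

theorem norm_sq_Lp (f : Lp ℂ 2 vol01) : ‖f‖ ^ 2 = ∫ x, ‖f x‖ ^ 2 ∂vol01 := by
  rw [← inner_self_eq_norm_sq (𝕜 := ℂ), L2.inner_def, ← integral_re (L2.integrable_inner f f)]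
  simp only [inner_self_eq_norm_sq]

theorem norm_extend01_primitive_le (f : Lp ℂ 2 vol01) {t : ℝ} (ht : t ∈ Icc (0 : ℝ) 1) :
    ‖extend01 (primitive 0 f (Lp.memLp f)) t‖ ≤ ‖f‖ := by
  have hsub : Ioc 0 t ⊆ Icc 0 1 := Ioc_subset_Icc_self.trans (Icc_subset_Icc_right ht.2)
  have hfin : vol01 (Ioc 0 t) ≠ ∞ := measure_ne_top _ _
  have hinner : extend01 (primitive 0 f (Lp.memLp f)) t
      = inner ℂ (indicatorConstLp 2 measurableSet_Ioc hfin (1 : ℂ)) f := by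
    rw [extend01_primitive _ ht, zero_add, L2.inner_indicatorConstLp_one,
      intervalIntegral.integral_of_le ht.1, Measure.restrict_restrict measurableSet_Ioc,
      inter_eq_left.2 hsub]
  have hnorm : ‖indicatorConstLp 2 measurableSet_Ioc hfin (1 : ℂ)‖ ≤ 1 := by
    rw [norm_indicatorConstLp two_ne_zero ENNReal.ofNat_ne_top, norm_one, one_mul]
    refine Real.rpow_le_one measureReal_nonneg ?_ (by norm_num)
    exact (measureReal_mono (subset_univ _)).trans_eq (by simp)
  rw [hinner]
  exact (norm_inner_le_norm _ _).trans (mul_le_of_le_one_left (norm_nonneg f) hnorm)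

theorem normW21_primitive_le (f : Lp ℂ 2 vol01) :
    normW21 (primitive 0 f (Lp.memLp f)) ≤ √2 * ‖f‖ := by
  set w := primitive 0 f (Lp.memLp f)
  have hderiv : ∫ x, ‖deriv01 w x‖ ^ 2 ∂vol01 = ‖f‖ ^ 2 := by
    rw [norm_sq_Lp]
    refine integral_congr_ae ?_
    filter_upwards [deriv01_primitive (Lp.memLp f)] with x hx
    rw [hx]
  have hint : Integrable (fun x => ‖extend01 w x‖ ^ 2) vol01 :=
    ((memLp_top_extend01 w).mono_exponent le_top : MemLp _ 2 vol01).norm.integrable_sq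
  have hval : ∫ x, ‖extend01 w x‖ ^ 2 ∂vol01 ≤ ‖f‖ ^ 2 := by
    refine (integral_mono_ae hint (integrable_const (‖f‖ ^ 2)) ?_).trans_eq (by simp)
    filter_upwards [ae_restrict_mem measurableSet_Icc] with t ht
    exact pow_le_pow_left₀ (norm_nonneg _) (norm_extend01_primitive_le f ht) 2
  rw [normW21, ← integral_vol01,
    integral_add (memLp_deriv01 w).norm.integrable_sq hint, hderiv]
  refine (Real.sqrt_le_sqrt (add_le_add_right hval _)).trans_eq ?_
  rw [← two_mul, Real.sqrt_mul zero_le_two, Real.sqrt_sq (norm_nonneg f)]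

namespace WNeg

variable (q : WNeg)

/-- The functional that `q` induces on derivatives, `f ↦ q(∫₀ᵗ f)`. -/
def onDeriv : Lp ℂ 2 vol01 →ₗ[ℂ] ℂ where
  toFun f := q.pairing (primitive 0 f (Lp.memLp f))
  map_add' f g := by
    rw [← map_add]
    refine congrArg q.pairing (eq_primitive _ ?_ ?_).symm
    · simp only [extend01_add, extend01_zero_primitive, add_zero]
    · filter_upwards [Lp.coeFn_add f g, deriv01_primitive (Lp.memLp f),
        deriv01_primitive (Lp.memLp g), deriv01_add (primitive 0 f (Lp.memLp f))
          (primitive 0 g (Lp.memLp g))] with x hadd hf hg hderiv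
      rw [hderiv, hf, hg, hadd, Pi.add_apply]
  map_smul' c f := by
    rw [RingHom.id_apply, ← map_smul]
    refine congrArg q.pairing (eq_primitive _ ?_ ?_).symm
    · simp only [extend01_smul, extend01_zero_primitive, mul_zero]
    · filter_upwards [Lp.coeFn_smul c f, deriv01_primitive (Lp.memLp f),
        deriv01_smul c (primitive 0 f (Lp.memLp f))] with x hsmul hf hderiv
      rw [hderiv, hf, hsmul, Pi.smul_apply, smul_eq_mul]

theorem exists_norm_onDeriv_le : ∃ C, ∀ f, ‖q.onDeriv f‖ ≤ C * ‖f‖ := by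
  obtain ⟨C, hC⟩ := q.bounded
  refine ⟨|C| * √2, fun f => ?_⟩
  calc ‖q.onDeriv f‖ ≤ C * normW21 (primitive 0 f (Lp.memLp f)) := hC _
    _ ≤ |C| * (√2 * ‖f‖) := mul_le_mul (le_abs_self C) (normW21_primitive_le f)
        (Real.sqrt_nonneg _) (abs_nonneg C)
    _ = |C| * √2 * ‖f‖ := (mul_assoc _ _ _).symm

theorem exists_density : ∃ v : ℝ → ℂ, MemLp v 2 vol01 ∧
    ∀ w : W21, q.pairing w = q.pairing 1 * extend01 w 0 + ∫ x, v x * deriv01 w x ∂vol01 := by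
  obtain ⟨C, hC⟩ := q.exists_norm_onDeriv_le
  set v := (InnerProductSpace.toDual ℂ _).symm (q.onDeriv.mkContinuous C hC) with hv
  refine ⟨fun x => star (v x), (Lp.memLp v).star, fun w => ?_⟩
  have hw := memLp_deriv01 w
  have hdecomp : w = extend01 w 0 • (1 : W21) + primitive 0 (hw.toLp _) (Lp.memLp _) :=
    ext_extend01 fun t ht => by
      rw [extend01_add, extend01_smul, extend01_primitive _ ht,
        (isPrimitive_extend01 w).eq_add_integral t ht,
        intervalIntegral_congr_vol01 hw.coeFn_toLp unitInterval.zero_mem ht, zero_add]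
      exact congrArg (· + _) (mul_one _).symm
  have hriesz : q.pairing (primitive 0 (hw.toLp _) (Lp.memLp _)) = inner ℂ v (hw.toLp _) := by
    rw [hv, InnerProductSpace.toDual_symm_apply]
    rfl
  conv_lhs => rw [hdecomp]
  rw [map_add, map_smul, hriesz, L2.inner_def, smul_eq_mul, mul_comm]
  congr 1
  refine integral_congr_ae ?_
  filter_upwards [hw.coeFn_toLp] with x hx
  rw [hx, RCLike.inner_apply', starRingEnd_apply]

/-- The square integrable function `v` that represents `q` on derivatives, in the sense that
`q(w) = q(1) w(0) + ∫₀¹ v w'`. -/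
def density : ℝ → ℂ := q.exists_density.choose

theorem memLp_density : MemLp q.density 2 vol01 := q.exists_density.choose_spec.1

theorem pairing_eq (w : W21) :
    q.pairing w = q.pairing 1 * extend01 w 0 + ∫ x, q.density x * deriv01 w x ∂vol01 :=
  q.exists_density.choose_spec.2 w

end WNeg

end Density

theorem ofReal_re_extend01 {y : W21} (hy : star y = y) (t : ℝ) :
    ((extend01 y t).re : ℂ) = extend01 y t :=
  Complex.conj_eq_iff_re.1 (congrArg (extend01 · t) hy)

theorem ofReal_re_deriv01 {y : W21} (hy : star y = y) :
    ∀ᵐ x ∂vol01, ((deriv01 y x).re : ℂ) = deriv01 y x := by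
  filter_upwards [deriv01_star y] with x hx
  rw [hy] at hx
  exact Complex.conj_eq_iff_re.1 hx.symm

theorem re_extend01_mul (y : W21) {z : W21} (hz : star z = z) (t : ℝ) :
    (extend01 (y * z) t).re = (extend01 y t).re * (extend01 z t).re := by
  rw [extend01_mul, ← ofReal_re_extend01 hz, Complex.re_mul_ofReal, Complex.ofReal_re]

theorem re_deriv01_mul (y : W21) {z : W21} (hz : star z = z) : ∀ᵐ x ∂vol01,
    (deriv01 (y * z) x).re
      = (deriv01 y x).re * (extend01 z x).re + (extend01 y x).re * (deriv01 z x).re := by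
  filter_upwards [deriv01_mul y z, ofReal_re_deriv01 hz] with x hyz hz'
  rw [hyz, Complex.add_re, ← ofReal_re_extend01 hz, ← hz', Complex.re_mul_ofReal,
    Complex.re_mul_ofReal, Complex.ofReal_re, Complex.ofReal_re]

theorem re_extend01_nonneg {y : W21} (hy : star y = y) {a b m : ℝ} (hab : Icc a b ⊆ Icc 0 1)
    (hne : ∀ t ∈ Ioo a b, extend01 y t ≠ 0) (hm : m ∈ Ioo a b) (hym : 0 < (extend01 y m).re) :
    ∀ t ∈ Icc a b, 0 ≤ (extend01 y t).re := by
  have hcont : ContinuousOn (fun t => (extend01 y t).re) (Icc a b) :=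
    Complex.continuous_re.comp_continuousOn ((continuousOn_extend01 y).mono hab)
  have hIoo (t : ℝ) (ht : t ∈ Ioo a b) : 0 ≤ (extend01 y t).re := by
    by_contra! hneg
    obtain ⟨s, hs, hys⟩ := isPreconnected_Ioo.intermediate_value ht hm
      (hcont.mono Ioo_subset_Icc_self) ⟨hneg.le, hym.le⟩
    exact hne s hs (by rw [← ofReal_re_extend01 hy, show (extend01 y s).re = 0 from hys,
      Complex.ofReal_zero])
  have hclosure : closure (Ioo a b) = Icc a b := closure_Ioo (hm.1.trans hm.2).ne
  rw [← hclosure] at hcont ⊢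
  exact le_on_closure hIoo continuousOn_const hcont

theorem deriv01_add_smul_one (y : W21) (c : ℂ) : deriv01 (y + c • 1) = deriv01 y :=
  funext fun _ => deriv_add_const (c * 1)

theorem exists_mul_eq_one {y : W21} (hy : ∀ t ∈ Icc (0 : ℝ) 1, extend01 y t ≠ 0) :
    ∃ w : W21, y * w = 1 := by
  have hinv := (isPrimitive_extend01 y).inv hy
  have hcont := ((continuousOn_extend01 y).inv₀ hy).pow 2
  refine ⟨primitive (extend01 y 0)⁻¹ _
    ((memLp_top_of_continuousOn hcont.neg).mul' (memLp_deriv01 y)), ext_extend01 fun t ht => ?_⟩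
  rw [extend01_mul, extend01_primitive _ ht]
  exact (congrArg (extend01 y t * ·) (hinv.eq_add_integral t ht).symm).trans
    (mul_inv_cancel₀ (hy t ht))

theorem deriv01_of_mul_eq_one {y w : W21} (h : y * w = 1) :
    deriv01 w =ᵐ[vol01] fun x => -(deriv01 y x * extend01 w x ^ 2) := by
  filter_upwards [deriv01_mul y w] with x hx
  have hone : extend01 y x * extend01 w x = 1 := congrArg (extend01 · x) h
  have hderiv : deriv01 (1 : W21) x = 0 := deriv_const x (1 : ℂ)
  rw [h, hderiv] at hx
  linear_combination (-deriv01 w x) * hone - extend01 w x * hx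

section ShiftedInverse

variable {u v : W21} {ε : ℝ}

theorem star_eq_of_add_smul_one_mul_eq_one (hu : star u = u)
    (huv : (u + (ε : ℂ) • 1) * v = 1) : star v = v := by
  have hstar : star v * (u + (ε : ℂ) • 1) = 1 := by
    have h := congrArg star huv
    rwa [star_mul, star_add, hu, star_smul, star_one, Complex.star_def, Complex.conj_ofReal] at h
  exact left_inv_eq_right_inv hstar huv

theorem re_extend01_add_mul_eq_one (hu : star u = u)
    (huv : (u + (ε : ℂ) • 1) * v = 1) (t : ℝ) :
    ((extend01 u t).re + ε) * (extend01 v t).re = 1 := by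
  have h : (extend01 u t + ε * 1) * extend01 v t = 1 := congrArg (extend01 · t) huv
  rw [← ofReal_re_extend01 hu, mul_one,
    ← ofReal_re_extend01 (star_eq_of_add_smul_one_mul_eq_one hu huv)] at h
  exact_mod_cast h

theorem re_deriv01_of_add_mul_eq_one (hu : star u = u)
    (huv : (u + (ε : ℂ) • 1) * v = 1) :
    ∀ᵐ x ∂vol01, (deriv01 v x).re = -((deriv01 u x).re * (extend01 v x).re ^ 2) := by
  have hv := star_eq_of_add_smul_one_mul_eq_one hu huv
  have hderiv := deriv01_of_mul_eq_one huv
  rw [deriv01_add_smul_one] at hderiv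
  filter_upwards [hderiv, ofReal_re_deriv01 hu] with x hx hux
  rw [hx, ← hux, ← ofReal_re_extend01 hv]
  norm_cast

end ShiftedInverse

section Clamp

variable (a b : ℝ) (y : W21)

/-- The function that equals `y` on `[a,b]` and is continued outside by the constants `y(a)` and
`y(b)`; it is defined through its derivative, so this description needs `0 ≤ a ≤ b ≤ 1`. -/
def clamp : W21 :=
  primitive (extend01 y a) ((Ioc a b).indicator (deriv01 y))
    ((memLp_deriv01 y).indicator measurableSet_Ioc)

theorem deriv01_clamp : deriv01 (clamp a b y) =ᵐ[vol01] (Ioc a b).indicator (deriv01 y) :=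
  deriv01_primitive _

variable {a b}

theorem extend01_clamp (ha : 0 ≤ a) (hab : a ≤ b) (hb : b ≤ 1) {t : ℝ}
    (ht : t ∈ Icc (0 : ℝ) 1) : extend01 (clamp a b y) t = extend01 y (max a (min t b)) := by
  have ha01 : a ∈ Icc (0 : ℝ) 1 := ⟨ha, hab.trans hb⟩
  have hmem : max a (min t b) ∈ Icc (0 : ℝ) 1 :=
    ⟨ha.trans (le_max_left _ _), max_le ha01.2 ((min_le_left _ _).trans ht.2)⟩
  have hinter : Ioc 0 t ∩ Ioc a b = Ioc a (max a (min t b)) := by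
    ext s
    simp only [mem_inter_iff, mem_Ioc, le_max_iff, le_min_iff]
    grind
  rw [clamp, extend01_primitive _ ht, intervalIntegral.integral_of_le ht.1,
    setIntegral_indicator measurableSet_Ioc, hinter,
    ← intervalIntegral.integral_of_le (le_max_left _ _),
    ← (isPrimitive_extend01 y).sub_eq_integral ha01 hmem, add_sub_cancel]

theorem extend01_clamp_of_mem (ha : 0 ≤ a) (hb : b ≤ 1) {t : ℝ} (ht : t ∈ Icc a b) :
    extend01 (clamp a b y) t = extend01 y t := by
  rw [extend01_clamp y ha (ht.1.trans ht.2) hb (Icc_subset_Icc ha hb ht),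
    min_eq_left ht.2, max_eq_right ht.1]

theorem extend01_clamp_of_notMem (ha : 0 ≤ a) (hab : a ≤ b) (hb : b ≤ 1)
    (hya : a = 0 ∨ extend01 y a = 0) (hyb : b = 1 ∨ extend01 y b = 0) {t : ℝ}
    (ht : t ∈ Icc (0 : ℝ) 1) (htab : t ∉ Icc a b) : extend01 (clamp a b y) t = 0 := by
  rw [extend01_clamp y ha hab hb ht]
  rcases lt_or_ge t a with hta | hat
  · rw [max_eq_left ((min_le_left _ _).trans hta.le)]
    exact hya.resolve_left (ht.1.trans_lt hta).ne'
  · have hbt : b < t := lt_of_not_ge fun h => htab ⟨hat, h⟩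
    rw [min_eq_right hbt.le, max_eq_right hab]
    exact hyb.resolve_left (hbt.trans_le ht.2).ne

theorem star_clamp (ha : 0 ≤ a) (hab : a ≤ b) (hb : b ≤ 1) {y : W21} (hy : star y = y) :
    star (clamp a b y) = clamp a b y :=
  ext_extend01 fun t ht => by
    rw [extend01_star, extend01_clamp y ha hab hb ht, ← extend01_star, hy]

theorem deriv01_eq_zero_of_notMem {z : W21}
    (hz : ∀ t ∈ Icc (0 : ℝ) 1, t ∉ Icc a b → extend01 z t = 0) :
    ∀ᵐ x ∂vol01, x ∉ Icc a b → deriv01 z x = 0 := by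
  filter_upwards [ae_vol01_mem_Ioo] with x hx hxab
  have hlocal : extend01 z =ᶠ[𝓝 x] fun _ => 0 := by
    filter_upwards [Icc_mem_nhds hx.1 hx.2, isClosed_Icc.isOpen_compl.mem_nhds hxab] using hz
  rw [deriv01, hlocal.deriv_eq, deriv_const]

end Clamp

section Estimates

theorem integrable_mul_star {f g : ℝ → ℂ} (hf : MemLp f 2 vol01) (hg : MemLp g 2 vol01) :
    Integrable (fun x => f x * star (g x)) vol01 :=
  hf.integrable_mul hg.star

theorem exists_ae_eq_const_of_integral_mul_deriv01_eq_zero {f : ℝ → ℂ} (hf : MemLp f 2 vol01)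
    (h : ∀ z : W21, extend01 z 0 = 0 → extend01 z 1 = 0 →
      ∫ x, f x * star (deriv01 z x) ∂vol01 = 0) :
    ∃ C : ℂ, f =ᵐ[vol01] fun _ => C := by
  set C := ∫ x, f x ∂vol01
  have hf1 : Integrable f vol01 := hf.integrable (by norm_num)
  have hg : MemLp (fun x => f x - C) 2 vol01 := hf.sub (memLp_const C)
  have hmean : ∫ x, (f x - C) ∂vol01 = 0 := by
    rw [integral_sub hf1 (integrable_const C)]
    simp [C]
  have hortho : ∫ x, f x * star (f x - C) ∂vol01 = 0 := by
    rw [← h (primitive 0 _ hg) (extend01_zero_primitive hg) (by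
      rw [extend01_primitive hg unitInterval.one_mem, ← integral_vol01, hmean, zero_add])]
    refine integral_congr_ae ?_
    filter_upwards [deriv01_primitive (c := 0) hg] with x hx
    rw [hx]
  have hconst : ∫ x, C * star (f x - C) ∂vol01 = 0 := by
    rw [integral_const_mul]
    simp only [Complex.star_def, integral_conj, hmean, map_zero, mul_zero]
  have hsq : ∫ x, ‖f x - C‖ ^ 2 ∂vol01 = 0 := by
    rw [← Complex.ofReal_eq_zero, ← integral_complex_ofReal]
    calc ∫ x, ((‖f x - C‖ ^ 2 : ℝ) : ℂ) ∂vol01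
        = ∫ x, (f x * star (f x - C) - C * star (f x - C)) ∂vol01 :=
          integral_congr_ae <| .of_forall fun x => by
            simp only [← sub_mul, Complex.star_def, Complex.mul_conj', Complex.ofReal_pow]
      _ = 0 := by
          rw [integral_sub (integrable_mul_star hf hg)
            (integrable_mul_star (memLp_const C) hg), hortho, hconst, sub_zero]
  refine ⟨C, ?_⟩
  filter_upwards [(integral_eq_zero_iff_of_nonneg (fun x => sq_nonneg _)
    hg.norm.integrable_sq).1 hsq] with x hx
  exact sub_eq_zero.1 (norm_eq_zero.1 (pow_eq_zero_iff two_ne_zero |>.1 hx))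

theorem tendsto_integral_mul_sub_mul_sq {α : Type*} [MeasurableSpace α] {ν : Measure α}
    {f g : α → ℝ} {w : ℕ → α → ℝ} {M : ℝ} (hf : Integrable f ν) (hg : Integrable g ν)
    (hw : ∀ n, AEStronglyMeasurable (w n) ν) (hM : ∀ n, ∀ᵐ x ∂ν, |w n x| ≤ M)
    (hlim : ∀ᵐ x ∂ν, Tendsto (w · x) atTop (𝓝 0)) :
    Tendsto (fun n => ∫ x, (f x * w n x - g x * w n x ^ 2) ∂ν) atTop (𝓝 0) := by
  rw [← integral_zero α ℝ (μ := ν)]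
  refine tendsto_integral_of_dominated_convergence (fun x => |f x| * M + |g x| * M ^ 2)
    (fun n => (hf.1.mul (hw n)).sub (hg.1.mul ((hw n).pow 2)))
    ((hf.abs.mul_const M).add (hg.abs.mul_const (M ^ 2))) (fun n => ?_) ?_
  · filter_upwards [hM n] with x hx
    refine (norm_sub_le _ _).trans ?_
    rw [norm_mul, norm_mul, norm_pow]
    simp only [Real.norm_eq_abs]
    gcongr
  · filter_upwards [hlim] with x hx
    simpa using (hx.const_mul (f x)).sub ((hx.pow 2).const_mul (g x))

-- For `ε = 0` the right side is `p (z' - z u' / u) ^ 2`, which is Picone's identity; a positive `ε`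
-- lets `u` vanish, at the cost of the terms on the left.
theorem picone_inequality {c p ρ u u' z z' v ε : ℝ} (hc : 0 < c) (hp : c ≤ p)
    (hv : (u + ε) * v = 1) :
    ρ * z' * (ε * (z * v)) - ρ ^ 2 / (4 * c) * (ε * (z * v)) ^ 2
      ≤ ((p * z' + ρ * z) * z' + ρ * z' * z)
        - ((p * u' + ρ * u) * (z' * (z * v) + z * (z' * v + z * -(u' * v ^ 2)))
          + ρ * u' * (z * (z * v))) := by
  set w := ε * (z * v) with hw
  set d := z' - u' * z * v with hd
  have hsquare : 0 ≤ p * d ^ 2 + ρ * w * d + ρ ^ 2 / (4 * c) * w ^ 2 :=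
    calc 0 ≤ c * (d + ρ * w / (2 * c)) ^ 2 := by positivity
      _ = c * d ^ 2 + ρ * w * d + ρ ^ 2 / (4 * c) * w ^ 2 := by field_simp; ring
      _ ≤ p * d ^ 2 + ρ * w * d + ρ ^ 2 / (4 * c) * w ^ 2 := by gcongr
  have hid : ((p * z' + ρ * z) * z' + ρ * z' * z)
        - ((p * u' + ρ * u) * (z' * (z * v) + z * (z' * v + z * -(u' * v ^ 2)))
          + ρ * u' * (z * (z * v)))
      = p * d ^ 2 + ρ * w * d + ρ * z' * w := by
    rw [hd, hw]
    linear_combination (ρ * u' * z ^ 2 * v - 2 * ρ * z * z') * hv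
  linarith

theorem tendsto_mul_div_add_atTop {u z : ℝ} (hu : 0 ≤ u) (huz : u = 0 → z = 0) :
    Tendsto (fun n : ℕ => z * (1 / ((n : ℝ) + 1) / (u + 1 / ((n : ℝ) + 1)))) atTop (𝓝 0) := by
  rcases hu.eq_or_lt' with h0 | hpos
  · simp only [huz h0, zero_mul, tendsto_const_nhds]
  · have hε := tendsto_one_div_add_atTop_nhds_zero_nat (𝕜 := ℝ)
    simpa using (hε.div (hε.const_add u) (by simpa using hpos.ne')).const_mul z

end Estimates

namespace Problem

variable (S : Problem)

section Form

theorem mem_HU {y : W21} : y ∈ S.HU ↔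
    (S.U 0 0 = 1 → extend01 y 0 = 0) ∧ (S.U 1 1 = 1 → extend01 y 1 = 0) := by
  have h01 : S.U 0 1 = 0 := S.U_diag (by decide)
  have h10 : S.U 1 0 = 0 := S.U_diag (by decide)
  rw [show extend01 y 0 = bdry y 0 from extend01_coe y 0,
    show extend01 y 1 = bdry y 1 from extend01_coe y 1]
  change bdry y ∈ LinearMap.range (S.U - 1).mulVecLin ↔ _
  constructor
  · rintro ⟨v, hv⟩
    rw [← hv]
    constructor <;> intro h <;> simp [h, h01, h10]
  · rintro ⟨h0, h1⟩
    have hdiv (k : Fin 2) (hk : S.U k k = 1 → bdry y k = 0) :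
        (S.U k k - 1) * (bdry y k / (S.U k k - 1)) = bdry y k :=
      mul_div_cancel_of_imp' fun h => hk (sub_eq_zero.1 h)
    refine ⟨fun k => bdry y k / (S.U k k - 1), funext fun k => ?_⟩
    fin_cases k
    · simpa [h01, sub_mul] using hdiv 0 h0
    · simpa [h10, sub_mul] using hdiv 1 h1

theorem star_V (k : Fin 2) : star (S.V k k) = S.V k k := by
  simp only [V, Matrix.diagonal_apply_eq]
  split_ifs
  · exact star_zero ℂ
  · exact Complex.conj_ofReal _

theorem V_dotProduct (y z : W21) : (S.V *ᵥ bdry y) ⬝ᵥ star (bdry z)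
    = S.V 0 0 * (extend01 y 0 * star (extend01 z 0))
      + S.V 1 1 * (extend01 y 1 * star (extend01 z 1)) := by
  have h01 : S.V 0 1 = 0 := Matrix.diagonal_apply_ne _ (by decide)
  have h10 : S.V 1 0 = 0 := Matrix.diagonal_apply_ne _ (by decide)
  have hbdry (w : W21) : extend01 w 0 = bdry w 0 ∧ extend01 w 1 = bdry w 1 :=
    ⟨extend01_coe w 0, extend01_coe w 1⟩
  simp only [hbdry, Matrix.mulVec, dotProduct, Fin.sum_univ_two, h01, h10, Pi.star_apply]
  ring

theorem star_mem_HU {y : W21} (hy : y ∈ S.HU) : star y ∈ S.HU := by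
  simpa only [mem_HU, extend01_star, star_eq_zero] using hy

theorem mul_mem_HU {y : W21} (hy : y ∈ S.HU) (z : W21) : y * z ∈ S.HU := by
  rw [mem_HU] at hy ⊢
  simp only [extend01_mul]
  exact ⟨fun h => by rw [hy.1 h, zero_mul], fun h => by rw [hy.2 h, zero_mul]⟩

theorem form_eq_form_add (μ ν : ℂ) (y z : S.HU) :
    S.form μ y z = S.form ν y z + (ν - μ) * S.r.pairing ((y : W21) * star (z : W21)) := by
  simp only [form]
  ring

theorem form_smul_left (μ c : ℂ) (y z : S.HU) : S.form μ (c • y) z = c * S.form μ y z := by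
  have hint : ∫ t in (0 : ℝ)..1, (S.p t : ℂ) * deriv01 (c • (y : W21)) t * star (deriv01 z t)
      = c * ∫ t in (0 : ℝ)..1, (S.p t : ℂ) * deriv01 y t * star (deriv01 (z : W21) t) := by
    rw [← integral_vol01, ← integral_vol01, ← integral_const_mul]
    refine integral_congr_ae ?_
    filter_upwards [deriv01_smul c (y : W21)] with x hx
    rw [hx]
    ring
  have hprod : c • (y : W21) * star (z : W21) = c • ((y : W21) * star (z : W21)) :=
    smul_mul_assoc _ _ _
  dsimp only [form, Submodule.coe_smul]
  rw [hint, hprod, map_smul, map_smul, V_dotProduct, V_dotProduct]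
  simp only [extend01_smul, smul_eq_mul]
  ring

theorem form_star (μ : ℝ) (y z : S.HU) :
    S.form μ ⟨star y, S.star_mem_HU y.2⟩ ⟨star z, S.star_mem_HU z.2⟩ = star (S.form μ y z) := by
  have hint : ∫ t in (0 : ℝ)..1, (S.p t : ℂ) * deriv01 (star (y : W21)) t
      * star (deriv01 (star (z : W21)) t)
      = star (∫ t in (0 : ℝ)..1, (S.p t : ℂ) * deriv01 y t * star (deriv01 (z : W21) t)) := by
    rw [← integral_vol01, ← integral_vol01, Complex.star_def, ← integral_conj]
    refine integral_congr_ae ?_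
    filter_upwards [deriv01_star (y : W21), deriv01_star (z : W21)] with x hy hz
    simp [hy, hz]
  have hprod : star (y : W21) * star (star (z : W21)) = star ((y : W21) * star (z : W21)) :=
    (star_mul' _ _).symm
  have hμ : star (μ : ℂ) = μ := Complex.conj_ofReal μ
  dsimp only [form]
  rw [hint, hprod, S.q_real, S.r_real, V_dotProduct, V_dotProduct]
  simp only [extend01_star, star_add, star_sub, star_mul', S.star_V, hμ]

/-- The square integrable function that represents `q - μ r` on derivatives. -/
def density (μ : ℂ) (x : ℝ) : ℂ := S.q.density x - μ * S.r.density x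

theorem memLp_density (μ : ℂ) : MemLp (S.density μ) 2 vol01 :=
  S.q.memLp_density.sub (S.r.memLp_density.const_mul μ)

/-- The coefficient of `y(0)` in the form of the pencil, once `q - μ r` is represented by its
density; it collects the total masses of `q` and `r` and the entry of `V`. -/
def bdryCoeff (μ : ℂ) : ℂ := S.q.pairing 1 - μ * S.r.pairing 1 + S.V 0 0

/-- The quasi-derivative `p y' + v y`, where `v` is the density of `q - μ r`. The sign of `v` is
that of the representation `w ↦ ∫₀¹ v w'`, for which `q - μ r` is `-v'` inside `(0,1)`. -/
def quasiDeriv (μ : ℂ) (y : W21) (x : ℝ) : ℂ :=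
  S.p x * deriv01 y x + S.density μ x * extend01 y x

theorem memLp_quasiDeriv (μ : ℂ) (y : W21) : MemLp (S.quasiDeriv μ y) 2 vol01 :=
  ((memLp_deriv01 y).mul' S.p_memLp.ofReal : MemLp _ 2 vol01).add
    ((memLp_top_extend01 y).mul' (S.memLp_density μ))

/-- The integrand of the form of the pencil, once `q - μ r` is represented by its density. -/
def integrand (μ : ℂ) (y z : W21) (x : ℝ) : ℂ :=
  S.quasiDeriv μ y x * star (deriv01 z x)
    + S.density μ x * deriv01 y x * star (extend01 z x)

theorem integrable_integrand (μ : ℂ) (y z : W21) : Integrable (S.integrand μ y z) vol01 :=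
  ((S.memLp_quasiDeriv μ y).integrable_mul (memLp_deriv01 z).star).add
    (((S.memLp_density μ).integrable_mul (memLp_deriv01 y)).mul_of_top_left
      (memLp_top_extend01 z).star)

theorem pairing_sub_mul_pairing_eq (μ : ℂ) (w : W21) :
    S.q.pairing w - μ * S.r.pairing w = (S.q.pairing 1 - μ * S.r.pairing 1) * extend01 w 0
      + ∫ x, S.density μ x * deriv01 w x ∂vol01 := by
  have hint (v : WNeg) : Integrable (fun x => v.density x * deriv01 w x) vol01 :=
    v.memLp_density.integrable_mul (memLp_deriv01 w)
  simp only [density, sub_mul, mul_assoc]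
  rw [integral_sub (hint _) ((hint _).const_mul μ), integral_const_mul, S.q.pairing_eq w,
    S.r.pairing_eq w]
  ring

/-- The form of the pencil, extended from `H_U` to `W_2^1[0,1]` and with `q - μ r` represented by
its density. -/
def sobolevForm (μ : ℂ) (y z : W21) : ℂ :=
  ∫ x, S.integrand μ y z x ∂vol01 + S.bdryCoeff μ * (extend01 y 0 * star (extend01 z 0))
    + S.V 1 1 * (extend01 y 1 * star (extend01 z 1))

theorem form_eq_sobolevForm (μ : ℂ) (y z : S.HU) : S.form μ y z = S.sobolevForm μ y z := by
  have hint : Integrable (fun x => S.density μ x * deriv01 ((y : W21) * star (z : W21)) x) vol01 :=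
    (S.memLp_density μ).integrable_mul (memLp_deriv01 _)
  have hp : Integrable (fun x => (S.p x : ℂ) * deriv01 y x * star (deriv01 (z : W21) x)) vol01 :=
    ((memLp_deriv01 y).mul' S.p_memLp.ofReal : MemLp _ 2 vol01).integrable_mul
      (memLp_deriv01 z).star
  have hsum : ∫ x, S.integrand μ y z x ∂vol01
      = ∫ x, (S.p x : ℂ) * deriv01 y x * star (deriv01 (z : W21) x) ∂vol01
        + ∫ x, S.density μ x * deriv01 ((y : W21) * star (z : W21)) x ∂vol01 := by
    rw [← integral_add hp hint]
    refine integral_congr_ae ?_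
    filter_upwards [deriv01_mul (y : W21) (star (z : W21)), deriv01_star (z : W21)]
      with x hmul hstar
    rw [hmul, hstar, extend01_star, integrand, quasiDeriv]
    ring
  rw [sobolevForm, hsum, form, V_dotProduct, pairing_sub_mul_pairing_eq, ← integral_vol01,
    extend01_mul, extend01_star, bdryCoeff]
  ring

end Form

section QuasiDerivative

/-- The equation `T(μ) y = 0`, in its variational sense. -/
def IsSolution (μ : ℂ) (y : S.HU) : Prop := ∀ z : S.HU, S.form μ y z = 0

/-- `Q` is the continuous representative of the quasi-derivative of `y`, and `Q' = v y'`, where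
`v` is the density of `q - μ r`. As the quasi-derivative is `p y' + v y`, this says that `(y, Q)`
is a solution of a linear first-order system with integrable coefficients. -/
structure HasQuasiDeriv (μ : ℂ) (y : W21) (Q : ℝ → ℂ) : Prop where
  ae_eq : S.quasiDeriv μ y =ᵐ[vol01] Q
  isPrimitive : IsPrimitive Q (fun x => S.density μ x * deriv01 y x)

variable {S} {μ : ℂ}

theorem integral_integrand_eq {y : W21} {G : ℝ → ℂ}
    (hG : IsPrimitive G (fun x => S.density μ x * deriv01 y x)) (z : W21) :
    ∫ x, S.integrand μ y z x ∂vol01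
      = ∫ x, (S.quasiDeriv μ y x - G x) * star (deriv01 z x) ∂vol01
        + (G 1 * star (extend01 z 1) - G 0 * star (extend01 z 0)) := by
  have hparts := hG.mul (isPrimitive_extend01 (star z))
  have hf : MemLp (fun x => S.quasiDeriv μ y x - G x) 2 vol01 :=
    (S.memLp_quasiDeriv μ y).sub (hG.memLp_top.mono_exponent le_top)
  rw [← extend01_star, ← extend01_star,
    hparts.sub_eq_integral unitInterval.zero_mem unitInterval.one_mem, ← integral_vol01,
    ← integral_add (integrable_mul_star hf (memLp_deriv01 z)) hparts.integrable]
  refine integral_congr_ae ?_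
  filter_upwards [deriv01_star z] with x hx
  rw [hx, extend01_star, integrand]
  ring

theorem IsSolution.exists_hasQuasiDeriv {y : S.HU} (hy : S.IsSolution μ y) :
    ∃ Q, S.HasQuasiDeriv μ y Q := by
  set G : ℝ → ℂ := fun t => ∫ x in (0 : ℝ)..t, S.density μ x * deriv01 y x
  have hG0 : G 0 = 0 := intervalIntegral.integral_same
  have hint : Integrable (fun x => S.density μ x * deriv01 y x) vol01 :=
    (S.memLp_density μ).integrable_mul (memLp_deriv01 y)
  have hG : IsPrimitive G (fun x => S.density μ x * deriv01 y x) :=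
    ⟨hint, fun t _ => by rw [hG0, zero_add]⟩
  have hf : MemLp (fun x => S.quasiDeriv μ y x - G x) 2 vol01 :=
    (S.memLp_quasiDeriv μ y).sub (hG.memLp_top.mono_exponent le_top)
  obtain ⟨C, hC⟩ := exists_ae_eq_const_of_integral_mul_deriv01_eq_zero hf fun z h0 h1 => by
    have hform := S.form_eq_sobolevForm μ y ⟨z, S.mem_HU.2 ⟨fun _ => h0, fun _ => h1⟩⟩
    rw [hy, sobolevForm, integral_integrand_eq hG] at hform
    simpa only [h0, h1, star_zero, mul_zero, sub_zero, add_zero] using hform.symm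
  refine ⟨fun t => C + G t, ?_, ⟨hint, fun t _ => by rw [hG0, add_zero]⟩⟩
  filter_upwards [hC] with x hx
  rw [← hx, sub_add_cancel]

namespace HasQuasiDeriv

variable {Q Q' : ℝ → ℂ}

theorem form_eq {y : S.HU} (hQ : S.HasQuasiDeriv μ y Q) (z : S.HU) : S.form μ y z
    = (S.bdryCoeff μ * extend01 y 0 - Q 0) * star (extend01 (z : W21) 0)
      + (Q 1 + S.V 1 1 * extend01 y 1) * star (extend01 (z : W21) 1) := by
  have hdiff : ∫ x, (S.quasiDeriv μ y x - Q x) * star (deriv01 (z : W21) x) ∂vol01 = 0 := by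
    refine integral_eq_zero_of_ae ?_
    filter_upwards [hQ.ae_eq] with x hx
    rw [hx, sub_self, zero_mul, Pi.zero_apply]
  rw [form_eq_sobolevForm, sobolevForm, integral_integrand_eq hQ.isPrimitive, hdiff]
  ring

theorem apply_zero {y : S.HU} (hQ : S.HasQuasiDeriv μ y Q) (hy : S.IsSolution μ y)
    (hU : S.U 0 0 ≠ 1) : Q 0 = S.bdryCoeff μ * extend01 y 0 := by
  obtain ⟨z, h0, h1⟩ : ∃ z : W21, extend01 z 0 = 1 ∧ extend01 z 1 = 0 :=
    ⟨primitive 1 (fun _ => -1) (memLp_const _), extend01_zero_primitive _,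
      by simp [extend01_primitive _ unitInterval.one_mem]⟩
  have hz : z ∈ S.HU := S.mem_HU.2 ⟨fun h => absurd h hU, fun _ => h1⟩
  have hform := hQ.form_eq ⟨z, hz⟩
  rw [hy, h0, h1, star_one, star_zero, mul_one, mul_zero, add_zero] at hform
  exact (sub_eq_zero.1 hform.symm).symm

theorem apply_one {y : S.HU} (hQ : S.HasQuasiDeriv μ y Q) (hy : S.IsSolution μ y)
    (hU : S.U 1 1 ≠ 1) : Q 1 = -(S.V 1 1 * extend01 y 1) := by
  obtain ⟨z, h0, h1⟩ : ∃ z : W21, extend01 z 0 = 0 ∧ extend01 z 1 = 1 :=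
    ⟨primitive 0 (fun _ => 1) (memLp_const _), extend01_zero_primitive _,
      by simp [extend01_primitive _ unitInterval.one_mem]⟩
  have hz : z ∈ S.HU := S.mem_HU.2 ⟨fun _ => h0, fun h => absurd h hU⟩
  have hform := hQ.form_eq ⟨z, hz⟩
  rw [hy, h0, h1, star_one, star_zero, mul_one, mul_zero, zero_add] at hform
  exact eq_neg_of_add_eq_zero_left hform.symm

theorem add {y z : W21} (hy : S.HasQuasiDeriv μ y Q) (hz : S.HasQuasiDeriv μ z Q') :
    S.HasQuasiDeriv μ (y + z) fun t => Q t + Q' t where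
  ae_eq := by
    filter_upwards [hy.ae_eq, hz.ae_eq, deriv01_add y z] with x hQ hQ' hx
    rw [← hQ, ← hQ', quasiDeriv, hx, extend01_add, quasiDeriv, quasiDeriv]
    ring
  isPrimitive := by
    refine (hy.isPrimitive.add hz.isPrimitive).congr_ae ?_
    filter_upwards [deriv01_add y z] with x hx
    rw [hx, mul_add]

theorem smul {y : W21} (hy : S.HasQuasiDeriv μ y Q) (c : ℂ) :
    S.HasQuasiDeriv μ (c • y) fun t => c * Q t where
  ae_eq := by
    filter_upwards [hy.ae_eq, deriv01_smul c y] with x hQ hx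
    rw [← hQ, quasiDeriv, hx, extend01_smul, quasiDeriv]
    ring
  isPrimitive := by
    refine (hy.isPrimitive.const_mul c).congr_ae ?_
    filter_upwards [deriv01_smul c y] with x hx
    rw [hx, mul_left_comm]

end HasQuasiDeriv

end QuasiDerivative

section UniqueContinuation

variable {S} {μ : ℂ}

namespace HasQuasiDeriv

variable {y : W21} {Q : ℝ → ℂ}

theorem exists_norm_deriv_le (hQ : S.HasQuasiDeriv μ y Q) : ∃ c : ℝ, 0 < c ∧ ∀ᵐ x ∂vol01,
    ‖(deriv01 y x, S.density μ x * deriv01 y x)‖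
      ≤ (1 + ‖S.density μ x‖) ^ 2 / c * ‖(extend01 y x, Q x)‖ := by
  obtain ⟨c, hc, hp⟩ := S.p_unif_pos
  refine ⟨c, hc, ?_⟩
  filter_upwards [hp, hQ.ae_eq] with x hpx hQx
  set ρ := S.density μ x
  have hsystem : S.p x * deriv01 y x = Q x - ρ * extend01 y x := by
    rw [← hQx, quasiDeriv, add_sub_cancel_right]
  have hderiv : c * ‖deriv01 y x‖ ≤ (1 + ‖ρ‖) * ‖(extend01 y x, Q x)‖ :=
    calc c * ‖deriv01 y x‖ ≤ ‖(S.p x : ℂ) * deriv01 y x‖ := by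
          rw [norm_mul, Complex.norm_real, Real.norm_of_nonneg (hc.le.trans hpx)]
          gcongr
      _ ≤ ‖Q x‖ + ‖ρ‖ * ‖extend01 y x‖ := by
          rw [hsystem, ← norm_mul]
          exact norm_sub_le _ _
      _ ≤ ‖(extend01 y x, Q x)‖ + ‖ρ‖ * ‖(extend01 y x, Q x)‖ := by
          gcongr
          exacts [le_max_right _ _, le_max_left _ _]
      _ = (1 + ‖ρ‖) * ‖(extend01 y x, Q x)‖ := by ring
  have hpair : ‖(deriv01 y x, ρ * deriv01 y x)‖ ≤ (1 + ‖ρ‖) * ‖deriv01 y x‖ := by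
    rw [Prod.norm_mk, norm_mul, add_mul, one_mul]
    exact max_le_add_of_nonneg (norm_nonneg _) (by positivity)
  rw [div_mul_eq_mul_div, le_div_iff₀ hc]
  calc ‖(deriv01 y x, ρ * deriv01 y x)‖ * c ≤ (1 + ‖ρ‖) * ‖deriv01 y x‖ * c := by gcongr
    _ = (1 + ‖ρ‖) * (c * ‖deriv01 y x‖) := by ring
    _ ≤ (1 + ‖ρ‖) * ((1 + ‖ρ‖) * ‖(extend01 y x, Q x)‖) := by gcongr
    _ = (1 + ‖ρ‖) ^ 2 * ‖(extend01 y x, Q x)‖ := by ring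

theorem eq_zero_of_apply_eq_zero (hQ : S.HasQuasiDeriv μ y Q) {t : ℝ} (ht : t ∈ Icc (0 : ℝ) 1)
    (hyt : extend01 y t = 0) (hQt : Q t = 0) : y = 0 := by
  obtain ⟨c, hc, hle⟩ := hQ.exists_norm_deriv_le
  have hρ : MemLp (fun x => 1 + ‖S.density μ x‖) 2 vol01 :=
    (memLp_const (1 : ℝ)).add (S.memLp_density μ).norm
  have hzero := ((isPrimitive_extend01 y).prodMk hQ.isPrimitive).eq_zero_of_norm_le
    (hρ.integrable_sq.div_const c) hle (fun x => by positivity) ht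
    (Prod.mk_eq_zero.2 ⟨hyt, hQt⟩)
  exact ext_extend01 fun s hs => (Prod.mk_eq_zero.1 (hzero s hs)).1

theorem eq_zero_of_eqOn_zero (hQ : S.HasQuasiDeriv μ y Q) {a b : ℝ} (ha : 0 ≤ a) (hab : a < b)
    (hb : b ≤ 1) (h : ∀ t ∈ Ioo a b, extend01 y t = 0) : y = 0 := by
  have hsub : Ioo a b ⊆ Icc 0 1 := Ioo_subset_Icc_self.trans (Icc_subset_Icc ha hb)
  have : NeBot (ae (volume.restrict (Ioo a b))) := ae_restrict_neBot.2 (by simpa using hab)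
  obtain ⟨x, hx, hQx⟩ := ((ae_restrict_mem measurableSet_Ioo).and
    (ae_restrict_of_ae_restrict_of_subset hsub hQ.ae_eq)).exists
  have hderiv : deriv01 y x = 0 := by
    have hlocal : extend01 y =ᶠ[𝓝 x] fun _ => 0 := by
      filter_upwards [Ioo_mem_nhds hx.1 hx.2] with t ht using h t ht
    rw [deriv01, hlocal.deriv_eq, deriv_const]
  refine hQ.eq_zero_of_apply_eq_zero (hsub hx) (h x hx) ?_
  rw [← hQx, quasiDeriv, hderiv, h x hx, mul_zero, mul_zero, add_zero]

end HasQuasiDeriv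

namespace IsSolution

variable {y y₁ y₂ : S.HU}

theorem eq_zero_of_apply_zero_eq_zero (hy : S.IsSolution μ y) (hU : S.U 0 0 ≠ 1)
    (h0 : extend01 y 0 = 0) : (y : W21) = 0 := by
  obtain ⟨Q, hQ⟩ := hy.exists_hasQuasiDeriv
  exact hQ.eq_zero_of_apply_eq_zero unitInterval.zero_mem h0
    (by rw [hQ.apply_zero hy hU, h0, mul_zero])

theorem eq_zero_of_apply_one_eq_zero (hy : S.IsSolution μ y) (hU : S.U 1 1 ≠ 1)
    (h1 : extend01 y 1 = 0) : (y : W21) = 0 := by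
  obtain ⟨Q, hQ⟩ := hy.exists_hasQuasiDeriv
  exact hQ.eq_zero_of_apply_eq_zero unitInterval.one_mem h1
    (by rw [hQ.apply_one hy hU, h1, mul_zero, neg_zero])

theorem exists_eq_smul (h₁ : S.IsSolution μ y₁) (h₂ : S.IsSolution μ y₂) (hne : (y₂ : W21) ≠ 0) :
    ∃ k : ℂ, (y₁ : W21) = k • (y₂ : W21) := by
  obtain ⟨Q₁, hQ₁⟩ := h₁.exists_hasQuasiDeriv
  obtain ⟨Q₂, hQ₂⟩ := h₂.exists_hasQuasiDeriv
  have hcauchy (k : ℂ) (hy : extend01 y₁ 0 = k * extend01 y₂ 0) (hQ : Q₁ 0 = k * Q₂ 0) :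
      (y₁ : W21) = k • (y₂ : W21) := by
    refine sub_eq_zero.1 ?_
    rw [sub_eq_add_neg, ← neg_smul]
    refine (hQ₁.add (hQ₂.smul (-k))).eq_zero_of_apply_eq_zero unitInterval.zero_mem ?_ ?_
    · rw [extend01_add, extend01_smul, hy, neg_mul, add_neg_cancel]
    · rw [hQ, neg_mul, add_neg_cancel]
  by_cases hU : S.U 0 0 = 1
  · have hy₁ := (S.mem_HU.1 y₁.2).1 hU
    have hy₂ := (S.mem_HU.1 y₂.2).1 hU
    have hQ : Q₂ 0 ≠ 0 := fun h =>
      hne (hQ₂.eq_zero_of_apply_eq_zero unitInterval.zero_mem hy₂ h)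
    exact ⟨Q₁ 0 / Q₂ 0, hcauchy _ (by rw [hy₁, hy₂, mul_zero]) (div_mul_cancel₀ _ hQ).symm⟩
  · have hy : extend01 y₂ 0 ≠ 0 := fun h => hne (h₂.eq_zero_of_apply_zero_eq_zero hU h)
    have hk : extend01 y₁ 0 = extend01 y₁ 0 / extend01 y₂ 0 * extend01 y₂ 0 :=
      (div_mul_cancel₀ _ hy).symm
    refine ⟨_, hcauchy _ hk ?_⟩
    rw [hQ₁.apply_zero h₁ hU, hQ₂.apply_zero h₂ hU, mul_left_comm, ← hk]

theorem smul (hy : S.IsSolution μ y) (c : ℂ) : S.IsSolution μ (c • y) := fun z => by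
  rw [form_smul_left, hy, mul_zero]

theorem star_smul_eq {μ : ℝ} (hy : S.IsSolution μ y) (m : ℝ) :
    star (star (extend01 y m) • (y : W21)) = star (extend01 y m) • (y : W21) := by
  by_cases hne : (y : W21) = 0
  · simp [hne]
  have hstar : S.IsSolution μ ⟨star y, S.star_mem_HU y.2⟩ := fun z => by
    have h := S.form_star μ y ⟨star z, S.star_mem_HU z.2⟩
    rw [hy, star_zero] at h
    simpa only [star_star] using h
  obtain ⟨k, hk : star (y : W21) = k • (y : W21)⟩ := hstar.exists_eq_smul hy hne
  have hkm : star (extend01 y m) = k * extend01 y m := congrArg (extend01 · m) hk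
  rw [star_smul, hk, star_star, hkm, smul_smul, mul_comm]

end IsSolution

end UniqueContinuation

section Picone

variable (μ : ℂ) {c ε : ℝ} {u v z : W21}

theorem re_integrand {y z : W21} (hy : star y = y) (hz : star z = z) : ∀ᵐ x ∂vol01,
    (S.integrand μ y z x).re
      = (S.p x * (deriv01 y x).re + (S.density μ x).re * (extend01 y x).re) * (deriv01 z x).re
        + (S.density μ x).re * (deriv01 y x).re * (extend01 z x).re := by
  filter_upwards [ofReal_re_deriv01 hy, ofReal_re_deriv01 hz] with x hy' hz'
  rw [integrand, quasiDeriv, ← extend01_star, hz, ← hy', ← hz', ← ofReal_re_extend01 hy,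
    ← ofReal_re_extend01 hz]
  simp only [Complex.star_def, Complex.conj_ofReal, Complex.add_re, Complex.re_mul_ofReal,
    Complex.ofReal_re]

theorem re_sobolevForm {y z : W21} (hy : star y = y) (hz : star z = z) :
    (S.sobolevForm μ y z).re = ∫ x, (S.integrand μ y z x).re ∂vol01
      + (S.bdryCoeff μ).re * ((extend01 y 0).re * (extend01 z 0).re)
      + (S.V 1 1).re * ((extend01 y 1).re * (extend01 z 1).re) := by
  have hint : (∫ x, S.integrand μ y z x ∂vol01).re = ∫ x, (S.integrand μ y z x).re ∂vol01 :=
    (integral_re (S.integrable_integrand μ y z)).symm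
  have hre (t : ℝ) : extend01 y t * star (extend01 z t)
      = (((extend01 y t).re * (extend01 z t).re : ℝ) : ℂ) := by
    rw [← extend01_star, hz, Complex.ofReal_mul, ofReal_re_extend01 hy, ofReal_re_extend01 hz]
  rw [sobolevForm, hre, hre, Complex.add_re, Complex.add_re, hint, Complex.re_mul_ofReal,
    Complex.re_mul_ofReal]

theorem ae_le_re_integrand_sub (hc : 0 < c) (hp : ∀ᵐ x ∂vol01, c ≤ S.p x) (hu : star u = u)
    (hz : star z = z) (huv : (u + (ε : ℂ) • 1) * v = 1) :
    ∀ᵐ x ∂vol01, (S.density μ x).re * (deriv01 z x).re * (ε * (extend01 (z * v) x).re)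
        - (S.density μ x).re ^ 2 / (4 * c) * (ε * (extend01 (z * v) x).re) ^ 2
      ≤ (S.integrand μ z z x).re - (S.integrand μ u (z * (z * v)) x).re := by
  have hv := star_eq_of_add_smul_one_mul_eq_one hu huv
  have hzv : star (z * v) = z * v := by rw [star_mul', hz, hv]
  have hzzv : star (z * (z * v)) = z * (z * v) := by rw [star_mul', hz, hzv]
  filter_upwards [hp, re_deriv01_of_add_mul_eq_one hu huv, S.re_integrand μ hz hz,
    S.re_integrand μ hu hzzv, re_deriv01_mul z hv, re_deriv01_mul z hzv]
    with x hpx hv' hzz huzzv hzv' hzzv'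
  rw [hzz, huzzv, hzzv', hzv', hv', re_extend01_mul z hzv, re_extend01_mul z hv]
  exact picone_inequality hc hpx (re_extend01_add_mul_eq_one hu huv x)

/-- A lower bound for the gap in Picone's inequality, where `w = ε z / (u + ε)` measures the error
made by dividing by `u + ε` instead of `u`; it vanishes in the limit `ε → 0`. -/
def piconeDefect (c : ℝ) (z : W21) (w : ℝ → ℝ) : ℝ :=
  ∫ x, ((S.density μ x).re * (deriv01 z x).re * w x
      - (S.density μ x).re ^ 2 / (4 * c) * w x ^ 2) ∂vol01
    + (S.bdryCoeff μ).re * ((extend01 z 0).re * w 0)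
    + (S.V 1 1).re * ((extend01 z 1).re * w 1)

theorem integrable_density_mul_deriv01_re (z : W21) :
    Integrable (fun x => (S.density μ x).re * (deriv01 z x).re) vol01 :=
  (S.memLp_density μ).re.integrable_mul (memLp_deriv01 z).re

theorem integrable_density_sq (c : ℝ) :
    Integrable (fun x => (S.density μ x).re ^ 2 / (4 * c)) vol01 :=
  (S.memLp_density μ).re.integrable_sq.div_const _

theorem tendsto_piconeDefect (c : ℝ) (z : W21) {w : ℕ → ℝ → ℝ} {M : ℝ}
    (hw : ∀ n, ContinuousOn (w n) (Icc 0 1)) (hM : ∀ n, ∀ t ∈ Icc (0 : ℝ) 1, |w n t| ≤ M)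
    (hlim : ∀ t ∈ Icc (0 : ℝ) 1, Tendsto (w · t) atTop (𝓝 0)) :
    Tendsto (fun n => S.piconeDefect μ c z (w n)) atTop (𝓝 0) := by
  have hint := tendsto_integral_mul_sub_mul_sq (S.integrable_density_mul_deriv01_re μ z)
    (S.integrable_density_sq μ c)
    (fun n => (hw n).aestronglyMeasurable_of_isCompact isCompact_Icc measurableSet_Icc)
    (fun n => (ae_restrict_iff' measurableSet_Icc).2 (.of_forall (hM n)))
    ((ae_restrict_iff' measurableSet_Icc).2 (.of_forall hlim))
  have h0 := ((hlim 0 unitInterval.zero_mem).const_mul (extend01 z 0).re).const_mul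
    (S.bdryCoeff μ).re
  have h1 := ((hlim 1 unitInterval.one_mem).const_mul (extend01 z 1).re).const_mul (S.V 1 1).re
  simpa only [piconeDefect, mul_zero, add_zero] using (hint.add h0).add h1

theorem piconeDefect_le (hc : 0 < c) (hp : ∀ᵐ x ∂vol01, c ≤ S.p x) (hu : star u = u)
    (hz : star z = z) (huv : (u + (ε : ℂ) • 1) * v = 1) :
    S.piconeDefect μ c z (fun x => ε * (extend01 (z * v) x).re)
      ≤ (S.sobolevForm μ z z).re - (S.sobolevForm μ u (z * (z * v))).re := by
  have hv := star_eq_of_add_smul_one_mul_eq_one hu huv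
  have hzv : star (z * v) = z * v := by rw [star_mul', hz, hv]
  have hzzv : star (z * (z * v)) = z * (z * v) := by rw [star_mul', hz, hzv]
  have hbdry (t : ℝ) : (extend01 z t).re * (ε * (extend01 (z * v) t).re)
      = (extend01 z t).re * (extend01 z t).re
        - (extend01 u t).re * (extend01 (z * (z * v)) t).re := by
    rw [re_extend01_mul z hzv, re_extend01_mul z hv]
    linear_combination (extend01 z t).re ^ 2 * re_extend01_add_mul_eq_one hu huv t
  have hw : ContinuousOn (fun x => ε * (extend01 (z * v) x).re) (Icc 0 1) :=
    (Complex.continuous_re.comp_continuousOn (continuousOn_extend01 _)).const_mul ε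
  have hle := integral_mono_ae
    (((S.integrable_density_mul_deriv01_re μ z).mul_of_top_left
      (memLp_top_of_continuousOn hw)).sub ((S.integrable_density_sq μ c).mul_of_top_left
        (memLp_top_of_continuousOn (hw.pow 2))))
    ((S.integrable_integrand μ z z).re.sub (S.integrable_integrand μ u (z * (z * v))).re)
    (S.ae_le_re_integrand_sub μ hc hp hu hz huv)
  have hsub := integral_sub (S.integrable_integrand μ z z).re
    (S.integrable_integrand μ u (z * (z * v))).re
  simp only [Pi.sub_apply, Pi.mul_apply, Pi.pow_apply, RCLike.re_to_complex] at hle hsub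
  rw [piconeDefect, hbdry, hbdry, S.re_sobolevForm μ hz hz, S.re_sobolevForm μ hu hzzv]
  linarith

theorem re_sobolevForm_self_nonneg (hu : star u = u) (hz : star z = z)
    (hu0 : ∀ t ∈ Icc (0 : ℝ) 1, 0 ≤ (extend01 u t).re)
    (huz : ∀ t ∈ Icc (0 : ℝ) 1, extend01 u t = 0 → extend01 z t = 0)
    (horth : ∀ w : W21, S.sobolevForm μ u (z * w) = 0) : 0 ≤ (S.sobolevForm μ z z).re := by
  obtain ⟨c, hc, hp⟩ := S.p_unif_pos
  set ε : ℕ → ℝ := fun n => 1 / ((n : ℝ) + 1)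
  have hε (n : ℕ) : 0 < ε n := Nat.one_div_pos_of_nat
  have hinv (n : ℕ) : ∃ v : W21, (u + (ε n : ℂ) • 1) * v = 1 := by
    refine exists_mul_eq_one fun t ht h => (add_pos_of_nonneg_of_pos (hu0 t ht) (hε n)).ne' ?_
    have hre : (extend01 u t + ε n * 1).re = 0 := congrArg Complex.re h
    rwa [mul_one, Complex.add_re, Complex.ofReal_re] at hre
  choose v huv using hinv
  set w : ℕ → ℝ → ℝ := fun n t => ε n * (extend01 (z * v n) t).re
  have hweq (n : ℕ) (t : ℝ) : w n t = (extend01 z t).re * (ε n / ((extend01 u t).re + ε n)) := by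
    rw [div_eq_mul_inv, ← eq_inv_of_mul_eq_one_right (re_extend01_add_mul_eq_one hu (huv n) t)]
    simp only [w, re_extend01_mul z (star_eq_of_add_smul_one_mul_eq_one hu (huv n))]
    ring
  have hwcont (n : ℕ) : ContinuousOn (w n) (Icc 0 1) :=
    (Complex.continuous_re.comp_continuousOn (continuousOn_extend01 _)).const_mul (ε n)
  obtain ⟨M, hM⟩ := isCompact_Icc.exists_bound_of_continuousOn (continuousOn_extend01 z)
  have hwM (n : ℕ) (t : ℝ) (ht : t ∈ Icc (0 : ℝ) 1) : |w n t| ≤ M := by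
    have hnum := (hε n).le
    have hquot := div_le_one_of_le₀ (le_add_of_nonneg_left (hu0 t ht)) (add_nonneg (hu0 t ht) hnum)
    rw [hweq, abs_mul, abs_of_nonneg (div_nonneg hnum (add_nonneg (hu0 t ht) hnum))]
    exact (mul_le_of_le_one_right (abs_nonneg _) hquot).trans
      ((Complex.abs_re_le_norm _).trans (hM t ht))
  have hwlim (t : ℝ) (ht : t ∈ Icc (0 : ℝ) 1) : Tendsto (w · t) atTop (𝓝 0) := by
    simp only [hweq]
    refine tendsto_mul_div_add_atTop (hu0 t ht) fun h => ?_
    rw [huz t ht (by rw [← ofReal_re_extend01 hu, h, Complex.ofReal_zero]), Complex.zero_re]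
  refine le_of_tendsto' (S.tendsto_piconeDefect μ c z hwcont hwM hwlim) fun n => ?_
  simpa only [horth, Complex.zero_re, sub_zero] using S.piconeDefect_le μ hc hp hu hz (huv n)

end Picone

section Oscillation

variable {S} {μ a b : ℝ} {y v z : S.HU}

theorem sobolevForm_clamp_left (S : Problem) (μ : ℂ) (y : W21) {z : W21} (ha : 0 ≤ a)
    (hb : b ≤ 1) (hz : ∀ t ∈ Icc (0 : ℝ) 1, t ∉ Icc a b → extend01 z t = 0) :
    S.sobolevForm μ (clamp a b y) z = S.sobolevForm μ y z := by
  have hbdry (t : ℝ) (ht : t ∈ Icc (0 : ℝ) 1) :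
      extend01 (clamp a b y) t * star (extend01 z t) = extend01 y t * star (extend01 z t) := by
    by_cases htab : t ∈ Icc a b
    · rw [extend01_clamp_of_mem y ha hb htab]
    · rw [hz t ht htab, star_zero, mul_zero, mul_zero]
  have hint : ∫ x, S.integrand μ (clamp a b y) z x ∂vol01 = ∫ x, S.integrand μ y z x ∂vol01 := by
    refine integral_congr_ae ?_
    filter_upwards [ae_vol01_mem_Ioo, deriv01_clamp a b y, deriv01_eq_zero_of_notMem hz,
      Measure.ae_ne _ a] with x hx hclamp hderiv hxa
    by_cases hxab : x ∈ Icc a b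
    · have hxIoc : x ∈ Ioc a b := ⟨hxab.1.lt_of_ne' hxa, hxab.2⟩
      rw [integrand, integrand, quasiDeriv, quasiDeriv, hclamp, indicator_of_mem hxIoc,
        extend01_clamp_of_mem y ha hb hxab]
    · rw [integrand, integrand, hderiv hxab, hz x (Ioo_subset_Icc_self hx) hxab, star_zero,
        mul_zero, mul_zero, mul_zero, mul_zero]
  rw [sobolevForm, sobolevForm, hint, hbdry 0 unitInterval.zero_mem, hbdry 1 unitInterval.one_mem]

theorem clamp_mem_HU (ha : 0 ≤ a) (hab : a ≤ b) (hb : b ≤ 1)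
    (hya : a = 0 ∨ extend01 (y : W21) a = 0) (hyb : b = 1 ∨ extend01 (y : W21) b = 0) :
    clamp a b y ∈ S.HU := by
  refine S.mem_HU.2 ⟨fun hU => ?_, fun hU => ?_⟩
  · rw [extend01_clamp _ ha hab hb unitInterval.zero_mem, min_eq_left (ha.trans hab),
      max_eq_left ha]
    exact hya.elim (fun h => h ▸ (S.mem_HU.1 y.2).1 hU) id
  · rw [extend01_clamp _ ha hab hb unitInterval.one_mem, min_eq_right hb, max_eq_right hab]
    exact hyb.elim (fun h => h ▸ (S.mem_HU.1 y.2).2 hU) id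

namespace IsSolution

theorem exists_real (hy : S.IsSolution μ y) {m : ℝ} (hm : extend01 (y : W21) m ≠ 0) :
    ∃ v : S.HU, S.IsSolution μ v ∧ star (v : W21) = v ∧ 0 < (extend01 (v : W21) m).re ∧
      ∀ t, extend01 (v : W21) t = 0 ↔ extend01 (y : W21) t = 0 := by
  refine ⟨star (extend01 (y : W21) m) • y, hy.smul _, hy.star_smul_eq m, ?_, fun t => ?_⟩
  · rw [Submodule.coe_smul, extend01_smul, mul_comm, Complex.star_def, Complex.mul_conj,
      Complex.ofReal_re]
    exact Complex.normSq_pos.2 hm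
  · rw [Submodule.coe_smul, extend01_smul, mul_eq_zero, star_eq_zero, or_iff_right hm]

theorem clamp_ne_zero (hy : S.IsSolution μ y) (hy0 : (y : W21) ≠ 0) (ha : 0 ≤ a) (hab : a < b)
    (hb : b ≤ 1) : clamp a b y ≠ 0 := fun h => by
  obtain ⟨Q, hQ⟩ := hy.exists_hasQuasiDeriv
  refine hy0 (hQ.eq_zero_of_eqOn_zero ha hab hb fun t ht => ?_)
  rw [← extend01_clamp_of_mem _ ha hb (Ioo_subset_Icc_self ht), h]
  rfl

theorem form_clamp_self (hy : S.IsSolution μ y) (ha : 0 ≤ a) (hab : a ≤ b) (hb : b ≤ 1)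
    (hya : a = 0 ∨ extend01 (y : W21) a = 0) (hyb : b = 1 ∨ extend01 (y : W21) b = 0)
    (hz : (z : W21) = clamp a b y) : S.form μ z z = 0 := by
  rw [← hy z, form_eq_sobolevForm, form_eq_sobolevForm, hz]
  exact S.sobolevForm_clamp_left μ y ha hb fun t => extend01_clamp_of_notMem _ ha hab hb hya hyb

theorem re_form_self_nonneg (hv : S.IsSolution μ v) (hvreal : star (v : W21) = v)
    (hz : star (z : W21) = z) (ha : 0 ≤ a) (hab : a ≤ b) (hb : b ≤ 1)
    (hv0 : ∀ t ∈ Icc a b, 0 ≤ (extend01 (v : W21) t).re)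
    (hvz : ∀ t ∈ Icc a b, extend01 (v : W21) t = 0 → extend01 (z : W21) t = 0)
    (hzab : ∀ t ∈ Icc (0 : ℝ) 1, t ∉ Icc a b → extend01 (z : W21) t = 0) :
    0 ≤ (S.form μ z z).re := by
  rw [form_eq_sobolevForm]
  refine S.re_sobolevForm_self_nonneg μ (u := clamp a b v) (star_clamp ha hab hb hvreal) hz
    (fun t ht => ?_) (fun t ht hut => ?_) fun w => ?_
  · rw [extend01_clamp _ ha hab hb ht]
    exact hv0 _ ⟨le_max_left _ _, max_le hab (min_le_right _ _)⟩
  · by_cases htab : t ∈ Icc a b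
    · exact hvz t htab (extend01_clamp_of_mem (v : W21) ha hb htab ▸ hut)
    · exact hzab t ht htab
  · have hzw : (z : W21) * w ∈ S.HU := S.mul_mem_HU z.2 w
    rw [S.sobolevForm_clamp_left μ v ha hb fun t ht htab => by
      rw [extend01_mul, hzab t ht htab, zero_mul]]
    exact (S.form_eq_sobolevForm μ v ⟨_, hzw⟩).symm.trans (hv _)

theorem exists_eq_zero_of_re_form_neg (hv : S.IsSolution μ v) (hz : star (z : W21) = z)
    (ha : 0 ≤ a) (hab : a < b) (hb : b ≤ 1) (hza : a = 0 ∨ extend01 (z : W21) a = 0)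
    (hzb : b = 1 ∨ extend01 (z : W21) b = 0)
    (hzab : ∀ t ∈ Icc (0 : ℝ) 1, t ∉ Icc a b → extend01 (z : W21) t = 0)
    (hneg : (S.form μ z z).re < 0) : ∃ t ∈ Ioo a b, extend01 (v : W21) t = 0 := by
  by_contra! hne
  obtain ⟨m, hm⟩ := exists_between hab
  obtain ⟨w, hw, hwreal, hwm, hwv⟩ := hv.exists_real (hne m hm)
  have hwne (t : ℝ) (ht : t ∈ Ioo a b) : extend01 (w : W21) t ≠ 0 := mt (hwv t).1 (hne t ht)
  have hw0 : (w : W21) ≠ 0 := fun h => hwne m hm (by rw [h]; rfl)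
  refine hneg.not_ge (hw.re_form_self_nonneg hwreal hz ha hab.le hb
    (re_extend01_nonneg hwreal (Icc_subset_Icc ha hb) hwne hm hwm) (fun t ht hwt => ?_) hzab)
  rcases eq_endpoints_or_mem_Ioo_of_mem_Icc ht with rfl | rfl | ht
  · refine hza.elim (fun h0 => ?_) id
    subst h0
    exact (S.mem_HU.1 z.2).1 (by_contra fun hU => hw0 (hw.eq_zero_of_apply_zero_eq_zero hU hwt))
  · refine hzb.elim (fun h1 => ?_) id
    subst h1
    exact (S.mem_HU.1 z.2).2 (by_contra fun hU => hw0 (hw.eq_zero_of_apply_one_eq_zero hU hwt))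
  · exact absurd hwt (hwne t ht)

end IsSolution

theorem Positive.re_form_self_neg {ξ lam lam' : ℝ} (hξ : S.Positive ξ) (hlam : ξ < lam)
    (hlam' : lam < lam') (hz0 : z ≠ 0) (hz : S.form lam z z = 0) : (S.form lam' z z).re < 0 := by
  set R := S.r.pairing ((z : W21) * star (z : W21))
  have hre (ν : ℝ) : (S.form ν z z).re = (lam - ν) * R.re := by
    rw [S.form_eq_form_add ν lam, hz, zero_add, ← Complex.ofReal_sub, Complex.re_ofReal_mul]
  have hpos := hξ z hz0
  rw [hre] at hpos ⊢
  exact mul_neg_of_neg_of_pos (sub_neg.2 hlam') (pos_of_mul_pos_right hpos (sub_pos.2 hlam).le)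

theorem Positive.exists_eq_zero_mem_Ioo {ξ lam lam' : ℝ} (hξ : S.Positive ξ) (hlam : ξ < lam)
    (hlam' : lam < lam') (hy : S.IsSolution lam y) (hy0 : (y : W21) ≠ 0)
    (hv : S.IsSolution lam' v) (ha : 0 ≤ a) (hab : a < b) (hb : b ≤ 1)
    (hya : a = 0 ∨ extend01 (y : W21) a = 0) (hyb : b = 1 ∨ extend01 (y : W21) b = 0) :
    ∃ t ∈ Ioo a b, extend01 (v : W21) t = 0 := by
  obtain ⟨m, hm⟩ : ∃ m, extend01 (y : W21) m ≠ 0 := by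
    by_contra! h
    exact hy0 (ext_extend01 fun t _ => h t)
  obtain ⟨w, hw, hwreal, hwm, hwy⟩ := hy.exists_real hm
  have hw0 : (w : W21) ≠ 0 := fun h => (h ▸ hwm).false
  rw [← hwy] at hya hyb
  have hmem := S.clamp_mem_HU ha hab.le hb hya hyb
  have hz0 : (⟨clamp a b w, hmem⟩ : S.HU) ≠ 0 := fun h =>
    hw.clamp_ne_zero hw0 ha hab hb (congrArg Subtype.val h)
  refine hv.exists_eq_zero_of_re_form_neg (star_clamp ha hab.le hb hwreal) ha hab hb ?_ ?_
    (fun t => extend01_clamp_of_notMem _ ha hab.le hb hya hyb)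
    (hξ.re_form_self_neg hlam hlam' hz0 (hw.form_clamp_self ha hab.le hb hya hyb rfl))
  · rwa [extend01_clamp_of_mem _ ha hb ⟨le_rfl, hab.le⟩]
  · rwa [extend01_clamp_of_mem _ ha hb ⟨hab.le, le_rfl⟩]

theorem lt_of_isEigenvalueAbove (S : Problem) {ξ lam lam' : ℝ} {n : ℕ}
    (h : S.IsEigenvalueAbove ξ n lam) (h' : S.IsEigenvalueAbove ξ (n + 1) lam') : lam < lam' := by
  by_contra! hle
  have hcard : {ν : ℝ | ν ∈ Ioo ξ lam' ∧ S.IsEigenvalue (ν : ℂ)}.encard + 1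
      ≤ {ν : ℝ | ν ∈ Ioo ξ lam ∧ S.IsEigenvalue (ν : ℂ)}.encard + 1 := by
    gcongr
  rw [h.2.2, h'.2.2, Nat.cast_le] at hcard
  exact n.lt_succ_self.not_ge hcard

end Oscillation

end Problem

end SturmLiouville

end

open SturmLiouville in
theorem mainTheorem3_general (S : Problem) (ξ : ℝ) (hξ : S.Positive ξ) (lam lam' : ℝ)
    (hlam : ξ < lam) (hlam' : lam < lam') (y y' : S.HU) (hy : S.IsEigenfunction (lam : ℂ) y)
    (hy' : S.IsEigenfunction (lam' : ℂ) y') (a b : I) (hab : a < b)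
    (ha : a = 0 ∨ S.IsZero y a) (hb : b = 1 ∨ S.IsZero y b) :
    ∃ c : I, a < c ∧ c < b ∧ S.IsZero y' c := by
  have hzero (w : S.HU) (t : I) : S.IsZero w t ↔ extend01 (w : W21) t = 0 := by
    rw [Problem.IsZero, extend01_coe]
  rw [hzero] at ha hb
  obtain ⟨t, ht, hyt⟩ := hξ.exists_eq_zero_mem_Ioo hlam hlam' hy.2
    (fun h => hy.1 (Subtype.ext h)) hy'.2 a.2.1 hab b.2.2
    (ha.imp_left fun h => congrArg Subtype.val h) (hb.imp_left fun h => congrArg Subtype.val h)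
  exact ⟨⟨t, a.2.1.trans ht.1.le, ht.2.le.trans b.2.2⟩, ht.1, ht.2, (hzero _ _).2 hyt⟩

theorem mainTheorem3 (S : SturmLiouville.Problem) (ξ : ℝ) (hξ : S.Positive ξ)
    (n : ℕ) (hn : 2 ≤ n) (lam lam' : ℝ)
    (hlam : S.IsEigenvalueAbove ξ n lam) (hlam' : S.IsEigenvalueAbove ξ (n + 1) lam')
    (y y' : S.HU) (hy : S.IsEigenfunction (lam : ℂ) y) (hy' : S.IsEigenfunction (lam' : ℂ) y') :
    (∀ a b : I, a < b → S.IsZero y a → S.IsZero y b →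
      ∃ c : I, a < c ∧ c < b ∧ S.IsZero y' c) ∧
    (∀ a : I, S.IsZero y a →
      (0 < a → ∃ c : I, 0 < c ∧ c < a ∧ S.IsZero y' c) ∧
      (a < 1 → ∃ c : I, a < c ∧ c < 1 ∧ S.IsZero y' c)) := by
  have hzero := mainTheorem3_general S ξ hξ lam lam' hlam.1 (S.lt_of_isEigenvalueAbove hlam hlam')
    y y' hy hy'
  exact ⟨fun a b hab ha hb => hzero a b hab (.inr ha) (.inr hb), fun a ha =>
    ⟨fun h => hzero 0 a h (.inl rfl) (.inr ha), fun h => hzero a 1 h (.inr ha) (.inl rfl)⟩⟩
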